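/- Consider $M$ access points (APs) with $L$ antennas each and $N$ clusters of $K$ single-antenna users, with $L\ge N+1$. The channels $\mathbf h_{mnk}\sim\mathcal{CN}(\mathbf 0,\beta_{mnk}\mathbf I_L)$ from AP $m$ to user $k$ of cluster $n$ are mutually independent, with $\beta_{mnk}\ge 0$. All users of cluster $n$ send the same pilot $\sqrt\tau\,\boldsymbol\phi_n$, where $\boldsymbol\phi_1,\dots,\boldsymbol\phi_N\in\mathbb C^\tau$ are orthonormal, with pilot power $p_p\ge 0$, so AP $m$ receives $\mathbf Y_m=\sqrt{\tau p_p}\sum_{n,k}\mathbf h_{mnk}\boldsymbol\phi_n^{\mathrm H}+\mathbf N_m$, where the $\mathbf N_m\in\mathbb C^{L\times\tau}$ have i.i.d. $\mathcal{CN}(0,1)$ entries independent of the channels. Put $\bar{\mathbf H}_m=\mathbf Y_m[\boldsymbol\phi_1,\dots,\boldsymbol\phi_N]$, let $\hat{\mathbf h}_{mnk}=c_{mnk}\bar{\mathbf H}_m\mathbf e_n$ with $c_{mnk}=\frac{\sqrt{\tau p_p}\,\beta_{mnk}}{1+\tau p_p\sum_{i=1}^K\beta_{mni}}$ be the MMSE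 estimate of $\mathbf h_{mnk}$, and let $$\theta_{mnk}=\tfrac1L\,\mathbb E\|\hat{\mathbf h}_{mnk}\|^2=\frac{\tau p_p\beta_{mnk}^2}{1+\tau p_p\sum_{i=1}^K\beta_{mni}}.$$ AP $m$ uses the full-pilot zero-forcing precoders $$\mathbf w_{mn}=\frac{\bar{\mathbf H}_m(\bar{\mathbf H}_m^{\mathrm H}\bar{\mathbf H}_m)^{-1}\mathbf e_n}{\sqrt{\mathbb E\|\bar{\mathbf H}_m(\bar{\mathbf H}_m^{\mathrm H}\bar{\mathbf H}_m)^{-1}\mathbf e_n\|^2}},$$ which depend on its local CSI only. User $i$ of cluster $n$ is allocated the power $p_{ni}\ge 0$, and $p_n=\sum_i p_{ni}$. The data symbols are $s_{ni}=\rho_{ni}\hat s_{ni}+e_{ni}$ with $0\le\rho_{ni}\le1$ and independent $\hat s_{ni}\sim\mathcal{CN}(0,1)$, $e_{ni}\sim\mathcal{CN}(0,1-\rho_{ni}^2)$; symbols of different users are uncorrelated, and all $\hat s_{ni}$, $e_{ni}$ are jointly independent of the channels and the pilot noise. For a user $(n,k)$ let $\eta_{n'}=\sum_{m}\mathbf h_{mnk}^{\mathrm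 H}\mathbf w_{mn'}$ for each cluster $n'$, and define its effective SINR by $$\gamma_{nk}=\frac{p_{nk}|\mathbb E\eta_n|^2}{p_{nk}\mathbb E|\eta_n-\mathbb E\eta_n|^2+\sum_{i<k}p_{ni}\mathbb E|\eta_n|^2+\sum_{i>k}p_{ni}\mathbb E|\eta_n s_{ni}-\mathbb E\{\eta_n\}\hat s_{ni}|^2+\sum_{n'\ne n}p_{n'}\mathbb E|\eta_{n'}|^2+1}.$$ Then $\bar{\mathbf H}_m^{\mathrm H}\bar{\mathbf H}_m$ is almost surely invertible, all the expectations above exist and are finite, the normalizations of the precoders and the denominator of $\gamma_{nk}$ are positive, the inter-cluster interference through the estimated channel is nulled, i.e. $\hat{\mathbf h}_{mnk}^{\mathrm H}\mathbf w_{mn'}=0$ almost surely for all $m$ and all $n'\ne n$, and, for all finite $M$, $L\ge N+1$, $N$, $K$, $$\gamma_{nk}=\frac{(L-N)\,p_{nk}\Big(\sum_{m}\sqrt{\theta_{mnk}}\Big)^2}{(L-N)\Big(\sum_{m}\sqrt{\theta_{mnk}}\Big)^2\Big(\sum_{i<k}p_{ni}+\sum_{i>k}p_{ni}(2-2\rho_{ni})\Big)+\Big(\sum_{n'}p_{n'}\Big)\sum_{m}(\beta_{mnk}-\theta_{mnk})+1}.$$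 -/

import Mathlib

open MeasureTheory ProbabilityTheory
open scoped Matrix

noncomputable section

namespace CellFree

/-- The circularly symmetric complex Gaussian law `CN(0, v)` on `ℂ` (for `v ≥ 0`): real and
imaginary part are independent real Gaussians with mean `0` and variance `v / 2`. -/
def complexGaussian (v : ℝ) : Measure ℂ :=
  ((gaussianReal 0 (v / 2).toNNReal).prod (gaussianReal 0 (v / 2).toNNReal)).map
    Complex.measurableEquivRealProd.symm

/-- The deterministic parameters of a cell-free massive MIMO-NOMA system with `M` access points
of `L` antennas each, `N` clusters of `K` single-antenna users, and pilots of length `τ`. -/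
structure System (M N K L τ : ℕ) where
  /-- large-scale fading coefficients -/
  β : Fin M → Fin N → Fin K → ℝ
  β_nonneg : ∀ m n k, 0 ≤ β m n k
  /-- pilot transmit power -/
  pilotPower : ℝ
  pilotPower_nonneg : 0 ≤ pilotPower
  /-- pilot of each cluster: the columns of a `τ × N` matrix, which are orthonormal -/
  Φ : Matrix (Fin τ) (Fin N) ℂ
  Φ_orthonormal : Φᴴ * Φ = 1
  /-- downlink power allocated to each user -/
  p : Fin N → Fin K → ℝ
  p_nonneg : ∀ n k, 0 ≤ p n k
  /-- correlation coefficient between each data symbol and its estimate -/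
  ρ : Fin N → Fin K → ℝ
  ρ_nonneg : ∀ n k, 0 ≤ ρ n k
  ρ_le_one : ∀ n k, ρ n k ≤ 1

/-- The random quantities of the system on a probability space, with their joint law:
independent Rayleigh-fading channels `h m n k ∼ CN(0, β m n k • I_L)`, independent pilot noise
matrices with i.i.d. `CN(0, 1)` entries, and data symbols `s n i = ρ n i * sHat n i + e n i`
with `sHat n i ∼ CN(0, 1)` and an independent error `e n i ∼ CN(0, 1 - (ρ n i) ^ 2)`. -/
structure RandomModel {M N K L τ : ℕ} (S : System M N K L τ)
    {Ω : Type*} [MeasurableSpace Ω] (P : Measure Ω) where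
  h : Fin M → Fin N → Fin K → Ω → Fin L → ℂ
  pilotNoise : Fin M → Ω → Matrix (Fin L) (Fin τ) ℂ
  sHat : Fin N → Fin K → Ω → ℂ
  e : Fin N → Fin K → Ω → ℂ
  h_law : ∀ m n k l, HasLaw (fun ω => h m n k ω l) (complexGaussian (S.β m n k)) P
  pilotNoise_law : ∀ m l t, HasLaw (fun ω => pilotNoise m ω l t) (complexGaussian 1) P
  /-- all entries of all channels and of all pilot noise matrices are mutually independent -/
  indep_channel_noise : iIndepFun (β := fun _ => ℂ)
    (fun (j : (Fin M × Fin N × Fin K × Fin L) ⊕ (Fin M × Fin L × Fin τ)) ω =>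
      Sum.elim (fun q => h q.1 q.2.1 q.2.2.1 ω q.2.2.2)
        (fun q => pilotNoise q.1 ω q.2.1 q.2.2) j) P
  sHat_law : ∀ n i, HasLaw (sHat n i) (complexGaussian 1) P
  e_law : ∀ n i, HasLaw (e n i) (complexGaussian (1 - S.ρ n i ^ 2)) P
  indep_sHat_e : ∀ n i, IndepFun (sHat n i) (e n i) P
  /-- data symbols of different users are uncorrelated -/
  uncorrelated : ∀ n i n' i', (n, i) ≠ (n', i') →
    ∫ ω, (S.ρ n i * sHat n i ω + e n i ω) * star (S.ρ n' i' * sHat n' i' ω + e n' i' ω) ∂P = 0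
  /-- the data symbols and their estimates are independent of the channels and the noise -/
  indep_data_channel : IndepFun
    (fun ω (q : Fin N × Fin K) => (sHat q.1 q.2 ω, e q.1 q.2 ω))
    (fun ω => ((fun (q : Fin M × Fin N × Fin K × Fin L) => h q.1 q.2.1 q.2.2.1 ω q.2.2.2),
      (fun (q : Fin M × Fin L × Fin τ) => pilotNoise q.1 ω q.2.1 q.2.2))) P

namespace System

variable {M N K L τ : ℕ} (S : System M N K L τ)

/-- `1 + τ p_p ∑ᵢ β m n i` -/
def pilotVar (m : Fin M) (n : Fin N) : ℝ :=
  1 + τ * S.pilotPower * ∑ i, S.β m n i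

/-- the coefficient of the linear MMSE channel estimate -/
def c (m : Fin M) (n : Fin N) (k : Fin K) : ℝ :=
  √(τ * S.pilotPower) * S.β m n k / S.pilotVar m n

/-- the variance `θ m n k` of the entries of the channel estimate -/
def θ (m : Fin M) (n : Fin N) (k : Fin K) : ℝ :=
  τ * S.pilotPower * S.β m n k ^ 2 / S.pilotVar m n

/-- the total power of a cluster -/
def clusterPower (n : Fin N) : ℝ := ∑ k, S.p n k

end System

namespace RandomModel

variable {M N K L τ : ℕ} {S : System M N K L τ} {Ω : Type*} [MeasurableSpace Ω] {P : Measure Ω}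
  (R : RandomModel S P)

/-- data symbol of user `i` of cluster `n` -/
def s (n : Fin N) (i : Fin K) (ω : Ω) : ℂ := S.ρ n i * R.sHat n i ω + R.e n i ω

/-- received pilot signal at access point `m` -/
def pilotSignal (m : Fin M) (ω : Ω) : Matrix (Fin L) (Fin τ) ℂ :=
  ((√(τ * S.pilotPower) : ℝ) : ℂ) •
    (∑ n, ∑ k, Matrix.vecMulVec (R.h m n k ω) (star fun t => S.Φ t n)) + R.pilotNoise m ω

/-- the projection `H̄ₘ` of the received pilot signal on the pilots -/
def Hbar (m : Fin M) (ω : Ω) : Matrix (Fin L) (Fin N) ℂ := R.pilotSignal m ω * S.Φ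

/-- MMSE estimate of the channel `h m n k` -/
def hHat (m : Fin M) (n : Fin N) (k : Fin K) (ω : Ω) : Fin L → ℂ :=
  fun l => (S.c m n k : ℂ) * R.Hbar m ω l n

/-- the unnormalized zero-forcing direction `H̄ₘ (H̄ₘᴴ H̄ₘ)⁻¹ eₙ` -/
def zfDir (m : Fin M) (n : Fin N) (ω : Ω) : Fin L → ℂ :=
  (R.Hbar m ω * ((R.Hbar m ω)ᴴ * R.Hbar m ω)⁻¹) *ᵥ Pi.single n 1

/-- the squared Euclidean norm of the unnormalized zero-forcing direction -/
def zfDirNormSq (m : Fin M) (n : Fin N) (ω : Ω) : ℝ := ∑ l, ‖R.zfDir m n ω l‖ ^ 2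

/-- the full-pilot zero-forcing precoding vector of access point `m` for cluster `n` -/
def w (m : Fin M) (n : Fin N) (ω : Ω) : Fin L → ℂ :=
  fun l => R.zfDir m n ω l / ((√(∫ ω', R.zfDirNormSq m n ω' ∂P) : ℝ) : ℂ)

/-- the effective channel `∑ₘ h m n kᴴ w m n'` from the beam of cluster `n'` to user `k` of
cluster `n` -/
def η (n : Fin N) (k : Fin K) (n' : Fin N) (ω : Ω) : ℂ :=
  ∑ m, star (R.h m n k ω) ⬝ᵥ R.w m n' ω

/-- interference-plus-noise power at user `k` of cluster `n`: beamforming gain uncertainty,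
intra-cluster interference after SIC, residual interference due to imperfect SIC,
inter-cluster interference, and unit-variance receiver noise -/
def interference (n : Fin N) (k : Fin K) : ℝ :=
  S.p n k * (∫ ω, ‖R.η n k n ω - ∫ ω', R.η n k n ω' ∂P‖ ^ 2 ∂P)
  + ∑ i ∈ Finset.Iio k, S.p n i * (∫ ω, ‖R.η n k n ω‖ ^ 2 ∂P)
  + ∑ i ∈ Finset.Ioi k, S.p n i *
      (∫ ω, ‖R.η n k n ω * R.s n i ω - (∫ ω', R.η n k n ω' ∂P) * R.sHat n i ω‖ ^ 2 ∂P)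
  + ∑ n' ∈ Finset.univ.erase n, S.clusterPower n' * (∫ ω, ‖R.η n k n' ω‖ ^ 2 ∂P)
  + 1

/-- the effective SINR of user `k` of cluster `n` -/
def sinr (n : Fin N) (k : Fin K) : ℝ :=
  S.p n k * ‖∫ ω, R.η n k n ω ∂P‖ ^ 2 / R.interference n k

end RandomModel

end CellFree

end

noncomputable section

namespace CellFree

/-! Fix a user. Since the channel estimate is the linear MMSE estimate, the entries of `Hbar` and of
the estimation error h − ĥ of this one user are linear images of independent Gaussians with diagonal
covariance: variance `pilotVar` for the former, β − θ for the latter. Such a linear image has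
independent entries (`map_mulVec_pi_complexGaussian`, `pilotMap_cov`, `hasLaw_observed`), so the
precoders, being functions of `Hbar`, are independent of the errors.

The effective channel splits accordingly (`η_ae_eq`). Its part through the estimate is almost surely
deterministic because zero forcing inverts `Hbar`: it is 0 for the beam of another cluster and ∑ₘ
c/√(E‖zf‖²) for the own beam, with zf the unnormalized direction. Its part through the errors has
mean zero and second moment ∑ₘ(β − θ) for every beam, because E‖w‖² = 1 (`moments_errorChannel`).

There remains E‖zf‖², the mean of a diagonal entry of an inverse complex Wishart matrix
(`lintegral_inv_gram_apply`). By a Schur complement the entry is 1/(gᴴQg), where g is the column in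
question and Q projects on the complement of the other columns; Q has rank d = L − N + 1 and is
independent of g. Diagonalizing Q turns gᴴQg into a sum of d independent |zᵢ|², and 1/x = ∫ exp(−tx)
dt gives ∫ (1 + tv)^(−d) dt = 1/(v(d − 1)) = 1/(v(L − N)). Hence c/√(E‖zf‖²) = √(L − N)·√θ, and
collecting the interference terms (`interference_eq`) gives the closed form. -/

/-! ### The circularly symmetric complex Gaussian law and its linear images. -/

instance isProbabilityMeasure_complexGaussian (v : ℝ) :
    IsProbabilityMeasure (complexGaussian v) :=
  Measure.isProbabilityMeasure_map (by fun_prop)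

lemma integral_complexGaussian {E : Type*} [NormedAddCommGroup E] [NormedSpace ℝ E] (v : ℝ)
    (f : ℂ → E) : ∫ z, f z ∂complexGaussian v =
      ∫ q : ℝ × ℝ, f ⟨q.1, q.2⟩ ∂((gaussianReal 0 (v / 2).toNNReal).prod
        (gaussianReal 0 (v / 2).toNNReal)) := by
  rw [complexGaussian, integral_map_equiv]; rfl

/-- Each real coordinate has variance `v / 2`, whence the 4. The dependence on `‖t‖` alone is the
circular symmetry that makes complex covariances determine laws below. -/
lemma charFun_complexGaussian {v : ℝ} (hv : 0 ≤ v) (t : ℂ) :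
    charFun (complexGaussian v) t = Complex.exp (-(v * ‖t‖ ^ 2 / 4 : ℝ)) := by
  rw [charFun_apply, integral_complexGaussian]
  have h : ∀ q : ℝ × ℝ, Complex.exp ((inner ℝ (⟨q.1, q.2⟩ : ℂ) t : ℝ) * Complex.I) =
      Complex.exp (t.re * q.1 * Complex.I) * Complex.exp (t.im * q.2 * Complex.I) := by
    intro q
    rw [← Complex.exp_add, Complex.inner]
    congr 1
    simp
    ring
  simp_rw [h]
  rw [integral_prod_mul (f := fun x : ℝ => Complex.exp (t.re * x * Complex.I))
    (g := fun x : ℝ => Complex.exp (t.im * x * Complex.I)), ← charFun_apply_real,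
    ← charFun_apply_real, charFun_gaussianReal, charFun_gaussianReal, ← Complex.exp_add]
  congr 1
  have : ((v / 2).toNNReal : ℝ) = v / 2 := Real.coe_toNNReal _ (by positivity)
  rw [← Complex.normSq_eq_norm_sq, Complex.normSq_apply]
  have h2 : (((v / 2).toNNReal : ℝ) : ℂ) = v / 2 := by rw [this]; push_cast; rfl
  simp only [h2]
  push_cast
  ring

lemma memLp_id_complexGaussian (v : ℝ) : MemLp (id : ℂ → ℂ) 2 (complexGaussian v) := by
  rw [complexGaussian]
  have hg := memLp_id_gaussianReal' (μ := 0) (v := (v / 2).toNNReal) 2 (by simp)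
  have h1 := hg.comp_fst (gaussianReal 0 (v / 2).toNNReal)
  have h2 := hg.comp_snd (gaussianReal 0 (v / 2).toNNReal)
  rw [← MeasurableEquiv.coe_toEquiv, MeasurableEquiv.coe_toEquiv,
    memLp_map_measure_iff (by fun_prop) (by fun_prop)]
  have : MemLp (fun q : ℝ × ℝ => (q.1 : ℂ) + q.2 * Complex.I) 2
    ((gaussianReal 0 (v / 2).toNNReal).prod (gaussianReal 0 (v / 2).toNNReal)) :=
    (h1.ofReal (K := ℂ)).add ((h2.ofReal (K := ℂ)).mul_const _)
  refine this.ae_eq (.of_forall fun q => ?_)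
  simp [Complex.ext_iff, Complex.measurableEquivRealProd]

/-- The law is invariant under negation, so the mean equals its own negative. -/
lemma integral_id_complexGaussian (v : ℝ) : ∫ z, z ∂complexGaussian v = 0 := by
  have h : (complexGaussian v).map (fun z => -z) = complexGaussian v := by
    have hn := gaussianReal_map_neg (μ := 0) (v := (v / 2).toNNReal)
    simp only [neg_zero] at hn
    rw [complexGaussian, Measure.map_map (by fun_prop) (by fun_prop)]
    conv_rhs => rw [← hn, Measure.map_prod_map _ _ (by fun_prop) (by fun_prop),
      Measure.map_map (by fun_prop) (by fun_prop)]
    rfl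
  have h1 : ∫ z, z ∂complexGaussian v = -∫ z, z ∂complexGaussian v := by
    conv_lhs => rw [← h, integral_map (by fun_prop) (by fun_prop), integral_neg]
  exact self_eq_neg.mp h1

lemma integral_normSq_complexGaussian {v : ℝ} (hv : 0 ≤ v) :
    ∫ z, ‖z‖ ^ 2 ∂complexGaussian v = v := by
  rw [integral_complexGaussian]
  have hg := (memLp_id_gaussianReal' (μ := 0) (v := (v / 2).toNNReal) 2 (by simp)).integrable_sq
  simp only [id] at hg
  have h2 : ∫ x, x ^ 2 ∂gaussianReal 0 (v / 2).toNNReal = v / 2 := by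
    have := variance_fun_id_gaussianReal (μ := 0) (v := (v / 2).toNNReal)
    rw [variance_of_integral_eq_zero (by fun_prop) (by simp)] at this
    rw [this, Real.coe_toNNReal _ (by positivity)]
  have h : ∀ q : ℝ × ℝ, ‖(⟨q.1, q.2⟩ : ℂ)‖ ^ 2 = q.1 ^ 2 + q.2 ^ 2 := by
    intro q
    rw [← Complex.normSq_eq_norm_sq, Complex.normSq_apply]; ring
  simp_rw [h]
  rw [integral_add (hg.comp_fst _) (hg.comp_snd _), integral_fun_fst (fun x : ℝ => x ^ 2),
    integral_fun_snd (fun x : ℝ => x ^ 2), h2]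
  simp

/-- Multiplying by the density gives a Gaussian integral with rate `t + 1 / (2 * v)`; for `v = 0`
there is no density and the law is a Dirac mass. -/
lemma lintegral_exp_neg_mul_sq_gaussianReal {v : NNReal} {t : ℝ} (ht : 0 ≤ t) :
    ∫⁻ x, ENNReal.ofReal (Real.exp (-(t * x ^ 2))) ∂gaussianReal 0 v =
      ENNReal.ofReal (√(1 + 2 * t * v))⁻¹ := by
  rcases eq_or_ne v 0 with rfl | hv
  · simp [gaussianReal_zero_var]
  have hv' : (0 : ℝ) < v := NNReal.coe_pos.mpr hv.pos
  have hI : Integrable (fun x : ℝ => Real.exp (-(t * x ^ 2))) (gaussianReal 0 v) := by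
    refine Integrable.of_bound (by fun_prop) 1 (.of_forall fun x => ?_)
    rw [Real.norm_eq_abs, abs_of_pos (Real.exp_pos _)]
    exact Real.exp_le_one_iff.mpr (by nlinarith [mul_nonneg ht (sq_nonneg x)])
  rw [← ofReal_integral_eq_lintegral_ofReal hI (.of_forall fun _ => (Real.exp_pos _).le),
    integral_gaussianReal_eq_integral_smul hv]
  congr 1
  have : ∀ x : ℝ, gaussianPDFReal 0 v x • Real.exp (-(t * x ^ 2)) =
      (√(2 * Real.pi * v))⁻¹ * Real.exp (-(t + 1 / (2 * v)) * x ^ 2) := by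
    intro x
    rw [gaussianPDFReal_def, smul_eq_mul, mul_assoc, ← Real.exp_add]
    congr 2
    field_simp
    ring
  simp_rw [this]
  rw [integral_const_mul, integral_gaussian, ← Real.sqrt_inv, ← Real.sqrt_inv, ← Real.sqrt_mul
    (by positivity)]
  congr 1
  have := Real.pi_pos
  have h3 : 0 < 1 + 2 * t * v := by positivity
  have h4 : 0 < t + 1 / (2 * (v:ℝ)) := by positivity
  field_simp
  ring

/-- The two coordinates contribute one inverse square root each: for positive variance the squared
modulus is exponentially distributed. -/
lemma lintegral_exp_neg_mul_normSq_complexGaussian {v t : ℝ} (hv : 0 ≤ v) (ht : 0 ≤ t) :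
    ∫⁻ z, ENNReal.ofReal (Real.exp (-(t * ‖z‖ ^ 2))) ∂complexGaussian v =
      ENNReal.ofReal (1 + t * v)⁻¹ := by
  rw [complexGaussian, lintegral_map_equiv]
  have h : ∀ q : ℝ × ℝ, ENNReal.ofReal (Real.exp
      (-(t * ‖Complex.measurableEquivRealProd.symm q‖ ^ 2))) =
      ENNReal.ofReal (Real.exp (-(t * q.1 ^ 2))) * ENNReal.ofReal (Real.exp (-(t * q.2 ^ 2))) := by
    intro q
    rw [← ENNReal.ofReal_mul (Real.exp_pos _).le, ← Real.exp_add, ← Complex.normSq_eq_norm_sq,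
      Complex.normSq_apply]
    simp only [Complex.measurableEquivRealProd_symm_apply]
    congr 2
    ring
  simp_rw [h]
  rw [lintegral_prod_mul (f := fun x : ℝ => ENNReal.ofReal (Real.exp (-(t * x ^ 2))))
    (g := fun x : ℝ => ENNReal.ofReal (Real.exp (-(t * x ^ 2)))) (by fun_prop) (by fun_prop),
    lintegral_exp_neg_mul_sq_gaussianReal ht,
    ← ENNReal.ofReal_mul (by positivity), Real.coe_toNNReal _ (by positivity), ← mul_inv,
    Real.mul_self_sqrt (by positivity)]
  congr 2
  ring

/-- The image of a vector of independent complex Gaussians under a matrix which makes its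
entries uncorrelated is again a vector of independent complex Gaussians. -/
lemma map_mulVec_pi_complexGaussian {I J : Type*} [Fintype I] [Fintype J] [DecidableEq I]
    [DecidableEq J] (A : Matrix I J ℂ) {v : J → ℝ} {u : I → ℝ} (hv : ∀ j, 0 ≤ v j)
    (hu : ∀ i, 0 ≤ u i)
    (h : A * Matrix.diagonal (fun j => (v j : ℂ)) * Aᴴ = Matrix.diagonal (fun i => (u i : ℂ))) :
    (Measure.pi fun j => complexGaussian (v j)).map (fun x => A *ᵥ x) =
      Measure.pi fun i => complexGaussian (u i) := by
  have hm : Measurable (fun x : J → ℂ => A *ᵥ x) := by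
    refine measurable_pi_lambda _ fun i => ?_
    simp only [Matrix.mulVec, dotProduct]
    fun_prop
  have := Measure.isProbabilityMeasure_map (μ := Measure.pi fun j => complexGaussian (v j))
    hm.aemeasurable
  rw [← charFun_eq_pi_iff]
  intro t
  rw [Measure.map_map (by fun_prop) hm, charFun_apply,
    integral_map (by fun_prop) (by fun_prop)]
  -- The adjoint moves the matrix to the test vector, after which the characteristic function
  -- factorizes over the independent sources. No rank condition on `A` is needed.
  set s : J → ℂ := Aᴴ *ᵥ t.ofLp with hs
  have h1 : ∀ x : J → ℂ, inner ℝ ((WithLp.toLp 2 ∘ fun x => A *ᵥ x) x) t =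
      ∑ j, inner ℝ (x j) (s j) := by
    intro x
    rw [PiLp.inner_apply]
    simp only [Function.comp, Complex.inner, ← Complex.re_sum]
    congr 1
    simp only [hs, Matrix.mulVec, dotProduct, map_sum, map_mul, Finset.sum_mul, Finset.mul_sum,
      Matrix.conjTranspose_apply]
    rw [Finset.sum_comm]
    refine Finset.sum_congr rfl fun j _ => Finset.sum_congr rfl fun i _ => ?_
    simp only [RCLike.star_def]
    ring
  simp_rw [h1, Complex.ofReal_sum, Finset.sum_mul, Complex.exp_sum]
  rw [integral_fintype_prod_eq_prod (f := fun j (z : ℂ) =>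
    Complex.exp ((inner ℝ z (s j) : ℝ) * Complex.I))]
  simp_rw [← charFun_apply, charFun_complexGaussian (hv _), charFun_complexGaussian (hu _),
    ← Complex.exp_sum]
  congr 1
  -- The covariance identity enters only as a quadratic form at `t`, which is exactly the exponent
  -- of the characteristic function.
  have h2 : star t.ofLp ⬝ᵥ ((A * Matrix.diagonal (fun j => (v j : ℂ)) * Aᴴ) *ᵥ t.ofLp) =
      star t.ofLp ⬝ᵥ (Matrix.diagonal (fun i => (u i : ℂ)) *ᵥ t.ofLp) := by rw [h]
  have h3 : ∑ j, (v j : ℂ) * (‖s j‖ : ℂ) ^ 2 = ∑ i, (u i : ℂ) * (‖t i‖ : ℂ) ^ 2 := by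
    rw [← Matrix.mulVec_mulVec, ← Matrix.mulVec_mulVec, Matrix.dotProduct_mulVec, ← hs] at h2
    have h4 : star t.ofLp ᵥ* A = star s := by
      rw [hs, Matrix.star_mulVec, Matrix.conjTranspose_conjTranspose]
    rw [h4] at h2
    simp only [dotProduct, Matrix.mulVec_diagonal, Pi.star_apply, RCLike.star_def] at h2
    convert h2 using 2 with j _ i _
    · rw [← Complex.conj_mul']; ring
    · rw [← Complex.conj_mul']; ring
  have h5 := congrArg (fun z => -(z / 4)) h3
  simp only [Finset.sum_div, ← Finset.sum_neg_distrib] at h5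
  convert h5 using 2 <;> push_cast <;> rfl

/-! ### Inverse moments of Gaussian quadratic forms. -/

/-- In `ENNReal` this survives at `x = 0`, where both sides are infinite, so no almost sure
positivity is needed beforehand; positivity is later deduced from it. -/
lemma inv_ofReal_eq_lintegral_exp {x : ℝ} (hx : 0 ≤ x) :
    (ENNReal.ofReal x)⁻¹ = ∫⁻ t in Set.Ioi (0 : ℝ), ENNReal.ofReal (Real.exp (-(t * x))) := by
  rcases hx.eq_or_lt with rfl | hx
  · simp
  have hI := integrableOn_exp_mul_Ioi (neg_lt_zero.mpr hx) 0
  have h := integral_exp_mul_Ioi (neg_lt_zero.mpr hx) 0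
  have he : ∀ t : ℝ, Real.exp (-(t * x)) = Real.exp (-x * t) := fun t => by ring_nf
  simp_rw [he]
  rw [← ofReal_integral_eq_lintegral_ofReal hI (.of_forall fun _ => (Real.exp_pos _).le), h,
    ← ENNReal.ofReal_inv_of_pos hx]
  simp

lemma lintegral_inv_one_add_mul_pow {v : ℝ} (hv : 0 < v) {e : ℕ} (he : 1 ≤ e) :
    ∫⁻ t in Set.Ioi (0 : ℝ), ENNReal.ofReal ((1 + t * v)⁻¹ ^ (e + 1)) =
      ENNReal.ofReal (1 / (v * e)) := by
  have he' : (0 : ℝ) < e := by exact_mod_cast he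
  -- The antiderivative vanishes at infinity because `e ≥ 1`; its value at 0 gives the result.
  have hd : ∀ t ∈ Set.Ici (0 : ℝ), HasDerivAt (fun t : ℝ => -(v * e)⁻¹ * ((1 + t * v) ^ e)⁻¹)
      ((1 + t * v)⁻¹ ^ (e + 1)) t := by
    intro t ht
    have ht : 0 ≤ t := ht
    have hp : 0 < 1 + t * v := by positivity
    have h1 : HasDerivAt (fun t : ℝ => 1 + t * v) v t := by
      simpa using ((hasDerivAt_id t).mul_const v).const_add 1
    have h2 := ((h1.pow e).inv (by simp only [Pi.pow_apply]; positivity)).const_mul (-(v * e)⁻¹)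
    refine h2.congr_deriv ?_
    obtain ⟨k, rfl⟩ : ∃ k, e = k + 1 := ⟨e - 1, by omega⟩
    simp only [Pi.pow_apply, Nat.add_sub_cancel, inv_pow]
    field_simp
    ring
  have hlim : Filter.Tendsto (fun t : ℝ => -(v * e)⁻¹ * ((1 + t * v) ^ e)⁻¹) Filter.atTop
      (nhds 0) := by
    have h1 : Filter.Tendsto (fun t : ℝ => (1 + t * v) ^ e) Filter.atTop Filter.atTop :=
      (Filter.tendsto_pow_atTop (by omega)).comp
        (Filter.tendsto_atTop_add_const_left _ _ (Filter.tendsto_id.atTop_mul_const hv))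
    simpa using h1.inv_tendsto_atTop.const_mul (-(v * e)⁻¹)
  have hpos : ∀ t ∈ Set.Ioi (0 : ℝ), 0 ≤ (1 + t * v)⁻¹ ^ (e + 1) := by
    intro t ht
    have ht : 0 < t := ht
    positivity
  have hI := integrableOn_Ioi_deriv_of_nonneg' hd hpos hlim
  have h := integral_Ioi_of_hasDerivAt_of_nonneg' hd hpos hlim
  rw [← ofReal_integral_eq_lintegral_ofReal hI
    ((ae_restrict_iff' measurableSet_Ioi).mpr (.of_forall hpos)), h]
  simp

lemma lintegral_pi_prod {ι : Type*} [Fintype ι] {X : ι → Type*} [∀ i, MeasurableSpace (X i)]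
    (μ : ∀ i, Measure (X i)) [∀ i, IsProbabilityMeasure (μ i)] {f : ∀ i, X i → ENNReal}
    (hf : ∀ i, Measurable (f i)) :
    ∫⁻ x, ∏ i, f i (x i) ∂Measure.pi μ = ∏ i, ∫⁻ x, f i x ∂μ i := by
  have hi : iIndepFun (fun i (x : ∀ i, X i) => f i (x i)) (Measure.pi μ) :=
    iIndepFun_pi (fun i => (hf i).aemeasurable)
  have := lintegral_prod_eq_prod_lintegral_of_indepFun Finset.univ _ hi
    (fun i => (hf i).comp (measurable_pi_apply i))
  rw [this]
  exact Finset.prod_congr rfl fun i _ =>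
    (measurePreserving_eval μ i).lintegral_comp (hf i)

/-- Tonelli exchanges the expectation with the integral representing the inverse; independence makes
the Laplace transform a power of `(1 + t * v)⁻¹`, integrable in `t` from exponent 2 on. -/
lemma lintegral_inv_sum_normSq {ι : Type*} [Fintype ι] [DecidableEq ι] (s : Finset ι)
    (hs : 2 ≤ s.card) {v : ℝ} (hv : 0 < v) :
    ∫⁻ z, (ENNReal.ofReal (∑ i ∈ s, ‖z i‖ ^ 2))⁻¹
        ∂Measure.pi (fun _ : ι => complexGaussian v) =
      ENNReal.ofReal (1 / (v * (s.card - 1))) := by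
  have h0 : ∀ z : ι → ℂ, (ENNReal.ofReal (∑ i ∈ s, ‖z i‖ ^ 2))⁻¹ =
      ∫⁻ t in Set.Ioi (0 : ℝ), ENNReal.ofReal (Real.exp (-(t * ∑ i ∈ s, ‖z i‖ ^ 2))) :=
    fun z => inv_ofReal_eq_lintegral_exp (by positivity)
  simp_rw [h0]
  rw [lintegral_lintegral_swap (by fun_prop)]
  have h1 : ∀ t ∈ Set.Ioi (0 : ℝ), ∫⁻ z, ENNReal.ofReal (Real.exp (-(t * ∑ i ∈ s, ‖z i‖ ^ 2)))
      ∂Measure.pi (fun _ : ι => complexGaussian v) =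
      ENNReal.ofReal ((1 + t * v)⁻¹ ^ (s.card - 1 + 1)) := by
    intro t ht
    have ht : 0 < t := ht
    -- Coordinates outside `s` receive the factor 1, so that the product runs over the whole index
    -- type of the product measure.
    have h2 : ∀ z : ι → ℂ, ENNReal.ofReal (Real.exp (-(t * ∑ i ∈ s, ‖z i‖ ^ 2))) =
        ∏ i, (fun (i : ι) (w : ℂ) =>
          if i ∈ s then ENNReal.ofReal (Real.exp (-(t * ‖w‖ ^ 2))) else 1) i (z i) := by
      intro z
      rw [Finset.prod_ite_mem, Finset.univ_inter,
        ← ENNReal.ofReal_prod_of_nonneg fun _ _ => (Real.exp_pos _).le, ← Real.exp_sum,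
        Finset.mul_sum, Finset.sum_neg_distrib]
    rw [lintegral_congr h2, lintegral_pi_prod (fun _ : ι => complexGaussian v) (f := fun (i : ι) (w : ℂ) =>
      if i ∈ s then ENNReal.ofReal (Real.exp (-(t * ‖w‖ ^ 2))) else 1) fun i => by
        split_ifs <;> fun_prop]
    have h3 : ∀ i : ι, (∫⁻ w, (if i ∈ s then ENNReal.ofReal (Real.exp (-(t * ‖w‖ ^ 2))) else 1)
        ∂complexGaussian v) = if i ∈ s then ENNReal.ofReal (1 + t * v)⁻¹ else 1 := by
      intro i
      by_cases h : i ∈ s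
      · simp [h, lintegral_exp_neg_mul_normSq_complexGaussian hv.le ht.le]
      · simp [h]
    simp_rw [h3]
    rw [Finset.prod_ite_mem, Finset.univ_inter, Finset.prod_const, ENNReal.ofReal_pow
      (by positivity), Nat.sub_add_cancel (by omega)]
  rw [setLIntegral_congr_fun measurableSet_Ioi h1,
    lintegral_inv_one_add_mul_pow hv (by omega), Nat.cast_sub (by omega)]
  simp

/-- The mean of the inverse of the squared norm of the projection of an isotropic complex
Gaussian vector on a subspace of dimension at least two. -/
lemma lintegral_inv_quadForm {ι : Type*} [Fintype ι] [DecidableEq ι] {Q : Matrix ι ι ℂ}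
    (hQ : Q.IsHermitian) (hQQ : Q * Q = Q) {d : ℕ} (htr : Q.trace = d) (hd : 2 ≤ d)
    {v : ℝ} (hv : 0 < v) :
    ∫⁻ g, (ENNReal.ofReal (star g ⬝ᵥ (Q *ᵥ g)).re)⁻¹
        ∂Measure.pi (fun _ : ι => complexGaussian v) =
      ENNReal.ofReal (1 / (v * (d - 1))) := by
  set U : Matrix ι ι ℂ := (hQ.eigenvectorUnitary : Matrix ι ι ℂ) with hU
  have hUU : Uᴴ * U = 1 := (Matrix.mem_unitaryGroup_iff').mp hQ.eigenvectorUnitary.2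
  have hUU' : U * Uᴴ = 1 := (Matrix.mem_unitaryGroup_iff).mp hQ.eigenvectorUnitary.2
  set D : Matrix ι ι ℂ := Matrix.diagonal (fun i => (hQ.eigenvalues i : ℂ)) with hD
  have hspec : Q = U * D * Uᴴ := by
    have := hQ.spectral_theorem
    rw [Unitary.conjStarAlgAut_apply] at this
    exact this
  have hDD : D * D = D := by
    have : Uᴴ * (Q * Q) * U = Uᴴ * Q * U := by rw [hQQ]
    rw [hspec] at this
    have e1 : Uᴴ * (U * D * Uᴴ * (U * D * Uᴴ)) * U =
      (Uᴴ * U) * D * (Uᴴ * U) * D * (Uᴴ * U) := by simp only [Matrix.mul_assoc]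
    have e2 : Uᴴ * (U * D * Uᴴ) * U = (Uᴴ * U) * D * (Uᴴ * U) := by simp only [Matrix.mul_assoc]
    rw [e1, e2, hUU] at this
    simpa using this
  -- Idempotency leaves only the eigenvalues 0 and 1, and the trace counts the latter.
  have hev : ∀ i, hQ.eigenvalues i = 0 ∨ hQ.eigenvalues i = 1 := by
    intro i
    have h := congrFun (congrFun hDD i) i
    rw [hD, Matrix.diagonal_mul_diagonal, Matrix.diagonal_apply_eq, Matrix.diagonal_apply_eq] at h
    have h : hQ.eigenvalues i * hQ.eigenvalues i = hQ.eigenvalues i := by exact_mod_cast h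
    exact (IsIdempotentElem.iff_eq_zero_or_one (p := hQ.eigenvalues i)).mp h
  set s : Finset ι := Finset.univ.filter fun i => hQ.eigenvalues i = 1 with hs
  have hval : ∀ i, hQ.eigenvalues i = if i ∈ s then 1 else 0 := by
    intro i
    rcases hev i with h | h <;> simp [hs, h]
  have hcard : s.card = d := by
    have h := hQ.trace_eq_sum_eigenvalues
    rw [htr] at h
    simp_rw [hval] at h
    simp only [← RCLike.ofReal_sum, Finset.sum_ite_mem, Finset.univ_inter,
      Finset.sum_const, nsmul_eq_mul, mul_one] at h
    exact_mod_cast h.symm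
  have hquad : ∀ g : ι → ℂ, (star g ⬝ᵥ (Q *ᵥ g)).re = ∑ i ∈ s, ‖(Uᴴ *ᵥ g) i‖ ^ 2 := by
    intro g
    have h1 : star g ⬝ᵥ (Q *ᵥ g) = star (Uᴴ *ᵥ g) ⬝ᵥ (D *ᵥ (Uᴴ *ᵥ g)) := by
      rw [hspec, Matrix.star_mulVec, Matrix.conjTranspose_conjTranspose,
        ← Matrix.dotProduct_mulVec, Matrix.mulVec_mulVec, Matrix.mulVec_mulVec]
    rw [h1, dotProduct, Complex.re_sum, ← Finset.univ_inter s, ← Finset.sum_ite_mem]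
    refine Finset.sum_congr rfl fun i _ => ?_
    rw [hD, Matrix.mulVec_diagonal, hval]
    split_ifs
    · rw [Pi.star_apply, RCLike.star_def, Complex.ofReal_one, one_mul, Complex.conj_mul']
      norm_cast
    · simp
  simp_rw [hquad]
  -- Unitary invariance of the isotropic Gaussian: the coordinates in the eigenbasis have the
  -- original law.
  have hmap := map_mulVec_pi_complexGaussian Uᴴ (v := fun _ => v) (u := fun _ => v)
    (fun _ => hv.le) (fun _ => hv.le) (by
      rw [Matrix.conjTranspose_conjTranspose, ← Matrix.smul_one_eq_diagonal, Matrix.mul_smul,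
        Matrix.smul_mul, Matrix.mul_one, hUU])
  have hm : Measurable (fun g : ι → ℂ => Uᴴ *ᵥ g) := by
    refine measurable_pi_lambda _ fun i => ?_
    simp only [Matrix.mulVec, dotProduct]
    fun_prop
  rw [← hcard, ← lintegral_inv_sum_normSq s (hcard ▸ hd) hv]
  conv_rhs => rw [← hmap]
  rw [lintegral_map (by fun_prop) hm]

/-! ### Gram matrices, projections and zero forcing. -/

section Deterministic

variable {L N : ℕ}

/-- The orthogonal projection on the complement of the column space of `A`. -/
def complProj (A : Matrix (Fin L) (Fin N) ℂ) : Matrix (Fin L) (Fin L) ℂ :=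
  1 - A * (Aᴴ * A)⁻¹ * Aᴴ

lemma complProj_isHermitian (A : Matrix (Fin L) (Fin N) ℂ) : (complProj A).IsHermitian := by
  have h : ((Aᴴ * A)⁻¹).IsHermitian := (Matrix.isHermitian_conjTranspose_mul_self A).inv
  rw [complProj]
  refine Matrix.isHermitian_one.sub ?_
  rw [Matrix.IsHermitian, Matrix.conjTranspose_mul, Matrix.conjTranspose_mul, h.eq,
    Matrix.conjTranspose_conjTranspose, Matrix.mul_assoc]

lemma complProj_mul_self {A : Matrix (Fin L) (Fin N) ℂ} (hA : IsUnit (Aᴴ * A).det) :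
    complProj A * complProj A = complProj A := by
  have h : A * (Aᴴ * A)⁻¹ * Aᴴ * (A * (Aᴴ * A)⁻¹ * Aᴴ) = A * (Aᴴ * A)⁻¹ * Aᴴ := by
    have : A * (Aᴴ * A)⁻¹ * Aᴴ * (A * (Aᴴ * A)⁻¹ * Aᴴ) =
        A * ((Aᴴ * A)⁻¹ * (Aᴴ * A)) * (Aᴴ * A)⁻¹ * Aᴴ := by simp only [Matrix.mul_assoc]
    rw [this, Matrix.nonsing_inv_mul _ hA, Matrix.mul_one]
  simp only [complProj, Matrix.sub_mul, Matrix.mul_sub, h, Matrix.mul_one, Matrix.one_mul]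
  abel

lemma trace_complProj {A : Matrix (Fin L) (Fin N) ℂ} (hA : IsUnit (Aᴴ * A).det) :
    (complProj A).trace = (L : ℂ) - N := by
  rw [complProj, Matrix.trace_sub, Matrix.mul_assoc, Matrix.trace_mul_comm, Matrix.mul_assoc,
    Matrix.nonsing_inv_mul _ hA]
  simp

/-- A Hermitian idempotent turns the form into a squared norm; in particular, taking its real part
loses nothing. -/
lemma quadForm_complProj_eq {A : Matrix (Fin L) (Fin N) ℂ} (hA : IsUnit (Aᴴ * A).det)
    (g : Fin L → ℂ) : star g ⬝ᵥ (complProj A *ᵥ g) =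
      ((∑ l, ‖(complProj A *ᵥ g) l‖ ^ 2 : ℝ) : ℂ) := by
  have h : star g ⬝ᵥ (complProj A *ᵥ g) = star (complProj A *ᵥ g) ⬝ᵥ (complProj A *ᵥ g) := by
    rw [Matrix.star_mulVec, (complProj_isHermitian A).eq, ← Matrix.dotProduct_mulVec,
      Matrix.mulVec_mulVec, complProj_mul_self hA]
  rw [h, dotProduct]
  push_cast
  refine Finset.sum_congr rfl fun l _ => ?_
  rw [Pi.star_apply, RCLike.star_def, Complex.conj_mul']

/-- The second factor is the Schur complement of the Gram block of the other columns: the squared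
distance of column `n` from their span. -/
lemma det_gram_succ (G : Matrix (Fin L) (Fin (N + 1)) ℂ) (n : Fin (N + 1))
    (hA : IsUnit ((G.submatrix id n.succAbove)ᴴ * G.submatrix id n.succAbove).det) :
    (Gᴴ * G).det = ((G.submatrix id n.succAbove)ᴴ * G.submatrix id n.succAbove).det *
      (star (fun l => G l n) ⬝ᵥ (complProj (G.submatrix id n.succAbove) *ᵥ fun l => G l n)) := by
  set A := G.submatrix id n.succAbove with hAdef
  set g : Fin L → ℂ := fun l => G l n with hg
  -- This reindexing puts column `n` last, so that the Gram matrix takes block form.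
  let e : Fin N ⊕ Unit ≃ Fin (N + 1) :=
    ((finSuccEquiv' n).trans (Equiv.optionEquivSumPUnit (Fin N))).symm
  have hcols : G.submatrix id e = Matrix.fromCols A (Matrix.replicateCol Unit g) := by
    ext l j
    rcases j with j | j
    · simp [e, hAdef]
    · simp [e, hg]
  have := (Aᴴ * A).invertibleOfIsUnitDet hA
  have h1 : (Gᴴ * G).det = ((Gᴴ * G).submatrix e e).det := by rw [Matrix.det_submatrix_equiv_self]
  have h2 : (Gᴴ * G).submatrix e e = (G.submatrix id e)ᴴ * G.submatrix id e := by
    ext i j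
    simp [Matrix.mul_apply]
  rw [h1, h2, hcols, Matrix.conjTranspose_fromCols_eq_fromRows_conjTranspose,
    Matrix.fromRows_mul_fromCols, Matrix.det_fromBlocks₁₁]
  congr 1
  rw [Matrix.det_unique, Matrix.invOf_eq_nonsing_inv, complProj, Matrix.sub_mulVec,
    dotProduct_sub, Matrix.one_mulVec, Matrix.sub_apply]
  congr 1
  simp only [Matrix.mul_assoc, ← Matrix.mulVec_mulVec]
  rw [← Matrix.replicateCol_mulVec, ← Matrix.replicateCol_mulVec, ← Matrix.replicateCol_mulVec]
  rfl

/-- Cramer's rule: the cofactor is the Gram determinant of the other columns and cancels against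
that factor in `det_gram_succ`. -/
lemma inv_gram_apply_succ (G : Matrix (Fin L) (Fin (N + 1)) ℂ) (n : Fin (N + 1))
    (hA : IsUnit ((G.submatrix id n.succAbove)ᴴ * G.submatrix id n.succAbove).det) :
    (Gᴴ * G)⁻¹ n n =
      (star (fun l => G l n) ⬝ᵥ (complProj (G.submatrix id n.succAbove) *ᵥ fun l => G l n))⁻¹ := by
  have h2 : (Gᴴ * G).submatrix n.succAbove n.succAbove =
      (G.submatrix id n.succAbove)ᴴ * G.submatrix id n.succAbove := by
    ext i j
    simp [Matrix.mul_apply]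
  rw [Matrix.inv_def, Matrix.smul_apply, Matrix.adjugate_fin_succ_eq_det_submatrix, h2,
    det_gram_succ G n hA, Ring.inverse_eq_inv', smul_eq_mul, mul_inv]
  rw [Even.neg_one_pow ⟨n, rfl⟩, one_mul]
  rw [mul_right_comm, inv_mul_cancel₀ hA.ne_zero, one_mul]

/-- The unnormalized zero-forcing direction of a channel matrix. -/
def zeroForcing (G : Matrix (Fin L) (Fin N) ℂ) (n : Fin N) : Fin L → ℂ :=
  (G * (Gᴴ * G)⁻¹) *ᵥ Pi.single n 1

lemma conjTranspose_mulVec_zeroForcing {G : Matrix (Fin L) (Fin N) ℂ}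
    (hG : IsUnit (Gᴴ * G).det) (n : Fin N) : Gᴴ *ᵥ zeroForcing G n = Pi.single n 1 := by
  rw [zeroForcing, Matrix.mulVec_mulVec, ← Matrix.mul_assoc, Matrix.mul_nonsing_inv _ hG,
    Matrix.one_mulVec]

/-- The direction is G y with y the column `n` of the inverse Gram matrix, and Gᴴ sends it to the
unit vector, so pairing it with itself picks out the entry `n` of y. -/
lemma sum_normSq_zeroForcing {G : Matrix (Fin L) (Fin N) ℂ}
    (hG : IsUnit (Gᴴ * G).det) (n : Fin N) :
    ∑ l, ‖zeroForcing G n l‖ ^ 2 = ((Gᴴ * G)⁻¹ n n).re := by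
  have h : star (zeroForcing G n) ⬝ᵥ zeroForcing G n = star ((Gᴴ * G)⁻¹ n n) := by
    have h1 : zeroForcing G n = G *ᵥ ((Gᴴ * G)⁻¹ *ᵥ Pi.single n 1) := by
      rw [zeroForcing, Matrix.mulVec_mulVec]
    conv_lhs => rw [h1, Matrix.star_mulVec, ← Matrix.dotProduct_mulVec, ← h1,
      conjTranspose_mulVec_zeroForcing hG]
    simp
  have h2 := congrArg Complex.re h
  rw [RCLike.star_def, Complex.conj_re, dotProduct, Complex.re_sum] at h2
  rw [← h2]
  refine Finset.sum_congr rfl fun l _ => ?_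
  rw [Pi.star_apply, RCLike.star_def, Complex.conj_mul']
  norm_cast

end Deterministic

/-! ### Random matrices with independent Gaussian columns. -/

section GaussianMatrix

variable {L N : ℕ}

/-- The matrix with given columns. -/
def colMatrix (G : Fin N → Fin L → ℂ) : Matrix (Fin L) (Fin N) ℂ := Matrix.of fun l n => G n l

/-- The law of the columns of an `L × N` matrix with independent entries, those of the column `n`
with the law `CN(0, v n)`. -/
abbrev columnsLaw (L : ℕ) {N : ℕ} (v : Fin N → ℝ) : Measure (Fin N → Fin L → ℂ) :=
  Measure.pi fun n => Measure.pi fun _ : Fin L => complexGaussian (v n)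

lemma continuous_colMatrix : Continuous (colMatrix (L := L) (N := N)) := by
  refine continuous_matrix fun l n => ?_
  simp only [colMatrix, Matrix.of_apply]
  fun_prop

lemma continuous_gram :
    Continuous fun G : Fin N → Fin L → ℂ => (colMatrix G)ᴴ * colMatrix G :=
  continuous_colMatrix.matrix_conjTranspose.matrix_mul continuous_colMatrix

lemma measurable_det_gram :
    Measurable fun G : Fin N → Fin L → ℂ => ((colMatrix G)ᴴ * colMatrix G).det :=
  continuous_gram.matrix_det.measurable

lemma measurable_inv_gram_apply (i j : Fin N) :
    Measurable fun G : Fin N → Fin L → ℂ => ((colMatrix G)ᴴ * colMatrix G)⁻¹ i j := by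
  simp only [Matrix.inv_def, Matrix.smul_apply, Ring.inverse_eq_inv', smul_eq_mul]
  exact measurable_det_gram.inv.mul (continuous_gram.matrix_adjugate.matrix_elem i j).measurable

lemma measurable_zeroForcing (n : Fin N) :
    Measurable fun G : Fin N → Fin L → ℂ => zeroForcing (colMatrix G) n := by
  refine measurable_pi_lambda _ fun l => ?_
  simp only [zeroForcing, Matrix.mulVec_single_one, Matrix.col_apply, Matrix.mul_apply]
  refine Finset.measurable_sum _ fun i _ => Measurable.mul ?_ (measurable_inv_gram_apply i n)
  exact (continuous_colMatrix.matrix_elem l i).measurable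

lemma colMatrix_insertNth_submatrix (n : Fin (N + 1)) (g : Fin L → ℂ) (A : Fin N → Fin L → ℂ) :
    (colMatrix (n.insertNth g A)).submatrix id n.succAbove = colMatrix A := by
  ext l j
  simp [colMatrix]

lemma colMatrix_insertNth_col (n : Fin (N + 1)) (g : Fin L → ℂ) (A : Fin N → Fin L → ℂ) :
    (fun l => colMatrix (n.insertNth g A) l n) = g := by
  ext l
  simp [colMatrix]

/-- Here `N` counts the columns other than the distinguished one. The projection has rank `L - N ≥
2`, and the inverse moment lowers this by one more. -/
lemma lintegral_inv_quadForm_complProj (hL : N + 2 ≤ L) {v : ℝ} (hv : 0 < v)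
    {A : Matrix (Fin L) (Fin N) ℂ} (hA : IsUnit (Aᴴ * A).det) :
    ∫⁻ g, (ENNReal.ofReal (star g ⬝ᵥ (complProj A *ᵥ g)).re)⁻¹
      ∂Measure.pi (fun _ : Fin L => complexGaussian v) =
      ENNReal.ofReal (1 / (v * ((L : ℝ) - (N + 1 : ℕ)))) := by
  rw [lintegral_inv_quadForm (complProj_isHermitian A) (complProj_mul_self hA) (d := L - N)
    (by rw [trace_complProj hA, Nat.cast_sub (by omega)]) (by omega) hv, Nat.cast_sub (by omega)]
  push_cast
  ring_nf

/-- The inverse has a finite integral, hence is almost surely finite, which excludes the value 0. -/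
lemma ae_quadForm_complProj_pos (hL : N + 2 ≤ L) {v : ℝ} (hv : 0 < v)
    {A : Matrix (Fin L) (Fin N) ℂ} (hA : IsUnit (Aᴴ * A).det) :
    ∀ᵐ g ∂Measure.pi (fun _ : Fin L => complexGaussian v),
      0 < (star g ⬝ᵥ (complProj A *ᵥ g)).re := by
  have hc : Continuous fun g : Fin L → ℂ => (star g ⬝ᵥ (complProj A *ᵥ g)).re :=
    Complex.continuous_re.comp ((continuous_id.star).dotProduct
      (continuous_const.matrix_mulVec continuous_id))
  have h := ae_lt_top (μ := Measure.pi (fun _ : Fin L => complexGaussian v))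
    (f := fun g => (ENNReal.ofReal (star g ⬝ᵥ (complProj A *ᵥ g)).re)⁻¹)
    (ENNReal.measurable_ofReal.comp hc.measurable).inv
    (by rw [lintegral_inv_quadForm_complProj hL hv hA]; exact ENNReal.ofReal_ne_top)
  filter_upwards [h] with g hg
  simpa using hg

lemma columnsLaw_succ (v : Fin (N + 1) → ℝ) (n : Fin (N + 1)) :
    MeasurePreserving (fun q : (Fin L → ℂ) × (Fin N → Fin L → ℂ) =>
        (n.insertNth q.1 q.2 : Fin (N + 1) → Fin L → ℂ))
      ((Measure.pi fun _ : Fin L => complexGaussian (v n)).prod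
        (columnsLaw L fun j => v (n.succAbove j))) (columnsLaw L v) :=
  (measurePreserving_piFinSuccAbove
    (fun n => Measure.pi fun _ : Fin L => complexGaussian (v n)) n).symm _

/-- Induction on the number of columns: by `det_gram_succ` a new column multiplies the determinant
by its squared distance from the span of the old ones, which is almost surely positive. -/
lemma ae_isUnit_det_gram : ∀ {N : ℕ} (_ : N + 1 ≤ L) {v : Fin N → ℝ} (_ : ∀ n, 0 < v n),
    ∀ᵐ G ∂columnsLaw L v, IsUnit ((colMatrix G)ᴴ * colMatrix G).det
  | 0, _, _, _ => .of_forall fun G => by simp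
  | N + 1, hL, v, hv => by
    have hms : ∀ N : ℕ, MeasurableSet
        {G : Fin N → Fin L → ℂ | IsUnit ((colMatrix G)ᴴ * colMatrix G).det} := by
      intro N
      simp only [isUnit_iff_ne_zero]
      exact (measurable_det_gram (measurableSet_singleton 0)).compl
    have ih := ae_isUnit_det_gram (N := N) (by omega) (v := fun j => v ((0 : Fin _).succAbove j))
      fun _ => hv _
    have hmp := columnsLaw_succ (L := L) v 0
    have hms' : MeasurableSet {q : (Fin L → ℂ) × (Fin N → Fin L → ℂ) |
        IsUnit ((colMatrix ((0 : Fin (N + 1)).insertNth q.1 q.2 : Fin (N + 1) → Fin L → ℂ))ᴴ *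
          colMatrix ((0 : Fin (N + 1)).insertNth q.1 q.2 : Fin (N + 1) → Fin L → ℂ)).det} :=
      hmp.measurable (hms _)
    -- The swap makes the old columns the outer variable, so that they are fixed when the new one is
    -- drawn.
    rw [← hmp.map_eq, ae_map_iff hmp.aemeasurable (hms _), ← Measure.prod_swap,
      ae_map_iff (by fun_prop) hms']
    refine (Measure.ae_prod_iff_ae_ae (measurable_swap hms')).mpr ?_
    filter_upwards [ih] with A hA
    filter_upwards [ae_quadForm_complProj_pos (by omega) (hv 0) hA] with g hg
    have hA' := hA
    rw [← colMatrix_insertNth_submatrix 0 g A] at hA'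
    have h := det_gram_succ (colMatrix ((0 : Fin (N + 1)).insertNth g A)) 0 hA'
    rw [colMatrix_insertNth_submatrix, colMatrix_insertNth_col] at h
    simp only [Prod.swap_prod_mk]
    rw [h]
    refine hA.mul (isUnit_iff_ne_zero.mpr fun h0 => ?_)
    rw [h0] at hg
    simp at hg

/-- The mean of a diagonal entry of the inverse of a complex Wishart matrix. -/
lemma lintegral_inv_gram_apply (hL : N + 1 ≤ L) {v : Fin N → ℝ} (hv : ∀ n, 0 < v n) (n : Fin N) :
    ∫⁻ G, ENNReal.ofReal (((colMatrix G)ᴴ * colMatrix G)⁻¹ n n).re ∂columnsLaw L v =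
      ENNReal.ofReal (1 / (v n * ((L : ℝ) - N))) := by
  obtain ⟨N, rfl⟩ : ∃ k, N = k + 1 := ⟨N - 1, by have := n.pos; omega⟩
  have hmp := columnsLaw_succ (L := L) v n
  have hm : Measurable fun G : Fin (N + 1) → Fin L → ℂ =>
      ENNReal.ofReal (((colMatrix G)ᴴ * colMatrix G)⁻¹ n n).re :=
    ENNReal.measurable_ofReal.comp (Complex.measurable_re.comp (measurable_inv_gram_apply n n))
  have hm' : Measurable fun q : (Fin L → ℂ) × (Fin N → Fin L → ℂ) => ENNReal.ofReal
      (((colMatrix (n.insertNth q.1 q.2 : Fin (N + 1) → Fin L → ℂ))ᴴ *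
        colMatrix (n.insertNth q.1 q.2 : Fin (N + 1) → Fin L → ℂ))⁻¹ n n).re :=
    hm.comp hmp.measurable
  rw [← hmp.lintegral_comp hm, lintegral_prod_symm' _ hm']
  -- Conditionally on the other columns, the mean over column `n` is a constant: it sees them only
  -- through the rank of the projection.
  have h : ∀ᵐ A ∂columnsLaw L fun j => v (n.succAbove j),
      ∫⁻ g, ENNReal.ofReal (((colMatrix (n.insertNth g A))ᴴ * colMatrix (n.insertNth g A))⁻¹ n n).re
        ∂Measure.pi (fun _ : Fin L => complexGaussian (v n)) =
      ENNReal.ofReal (1 / (v n * ((L : ℝ) - (N + 1 : ℕ)))) := by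
    filter_upwards [ae_isUnit_det_gram (L := L) (N := N) (by omega)
      (v := fun j => v (n.succAbove j)) fun _ => hv _] with A hA
    rw [← lintegral_inv_quadForm_complProj (by omega) (hv n) hA]
    refine lintegral_congr_ae ?_
    filter_upwards [ae_quadForm_complProj_pos (by omega) (hv n) hA] with g hg
    have hA' := hA
    rw [← colMatrix_insertNth_submatrix n g A] at hA'
    have h := inv_gram_apply_succ (colMatrix (n.insertNth g A)) n hA'
    rw [colMatrix_insertNth_submatrix, colMatrix_insertNth_col] at h
    rw [h, ← ENNReal.ofReal_inv_of_pos hg]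
    congr 1
    rw [quadForm_complProj_eq hA, ← Complex.ofReal_inv, Complex.ofReal_re, Complex.ofReal_re]
  rw [lintegral_congr_ae h]
  simp

lemma lintegral_sum_normSq_zeroForcing (hL : N + 1 ≤ L) {v : Fin N → ℝ} (hv : ∀ n, 0 < v n)
    (n : Fin N) :
    ∫⁻ G, ENNReal.ofReal (∑ l, ‖zeroForcing (colMatrix G) n l‖ ^ 2) ∂columnsLaw L v =
      ENNReal.ofReal (1 / (v n * ((L : ℝ) - N))) := by
  rw [← lintegral_inv_gram_apply hL hv]
  refine lintegral_congr_ae ?_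
  filter_upwards [ae_isUnit_det_gram hL hv] with G hG
  rw [sum_normSq_zeroForcing hG]

lemma integrable_sum_normSq_zeroForcing (hL : N + 1 ≤ L) {v : Fin N → ℝ} (hv : ∀ n, 0 < v n)
    (n : Fin N) :
    Integrable (fun G => ∑ l, ‖zeroForcing (colMatrix G) n l‖ ^ 2) (columnsLaw L v) := by
  have hm : Measurable fun G : Fin N → Fin L → ℂ => ∑ l, ‖zeroForcing (colMatrix G) n l‖ ^ 2 :=
    Finset.measurable_sum _ fun l _ =>
      ((measurable_pi_apply l).comp (measurable_zeroForcing n)).norm.pow_const 2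
  rw [← lintegral_ofReal_ne_top_iff_integrable hm.aestronglyMeasurable
    (.of_forall fun G => by positivity), lintegral_sum_normSq_zeroForcing hL hv]
  exact ENNReal.ofReal_ne_top

lemma integral_sum_normSq_zeroForcing (hL : N + 1 ≤ L) {v : Fin N → ℝ} (hv : ∀ n, 0 < v n)
    (n : Fin N) :
    ∫ G, ∑ l, ‖zeroForcing (colMatrix G) n l‖ ^ 2 ∂columnsLaw L v =
      1 / (v n * ((L : ℝ) - N)) := by
  have hLN : (0 : ℝ) < (L : ℝ) - N := by
    have : ((N + 1 : ℕ) : ℝ) ≤ L := by exact_mod_cast hL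
    push_cast at this
    linarith
  have := hv n
  rw [integral_eq_lintegral_of_nonneg_ae (.of_forall fun G => by positivity)
    (integrable_sum_normSq_zeroForcing hL hv n).aestronglyMeasurable,
    lintegral_sum_normSq_zeroForcing hL hv, ENNReal.toReal_ofReal (by positivity)]

end GaussianMatrix

/-- Under the nested product measure the entries are already independent with the right laws, so
currying identifies the flat product with the nested one. -/
lemma hasLaw_columns {Ω : Type*} [MeasurableSpace Ω] {P : Measure Ω} {N L : ℕ} {v : Fin N → ℝ}
    {Y : Fin N × Fin L → Ω → ℂ} (hY : ∀ p, HasLaw (Y p) (complexGaussian (v p.1)) P)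
    (hi : iIndepFun Y P) : HasLaw (fun ω n l => Y (n, l) ω) (columnsLaw L v) P := by
  have h1 : iIndepFun (fun (p : Fin N × Fin L) (G : Fin N → Fin L → ℂ) => G p.1 p.2)
      (columnsLaw L v) := by
    refine iIndepFun_uncurry' (X := fun n l (G : Fin N → Fin L → ℂ) => G n l)
      (fun n l => by fun_prop) ?_ fun n => ?_
    · exact iIndepFun_pi (X := fun (n : Fin N) (g : Fin L → ℂ) => g) fun _ => aemeasurable_id
    · have h := iIndepFun_pi (μ := fun _ : Fin L => complexGaussian (v n))
        (X := fun _ (z : ℂ) => z) fun _ => aemeasurable_id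
      rw [iIndepFun_iff_hasLaw_pi_pi
        (μ := fun _ : Fin L => complexGaussian (v n))] at h
      · rw [iIndepFun_iff_hasLaw_pi_pi
          (μ := fun _ : Fin L => complexGaussian (v n))]
        · exact (measurePreserving_eval (fun n => Measure.pi fun _ : Fin L =>
            complexGaussian (v n)) n).hasLaw
        · exact fun l => ((measurePreserving_eval (fun _ : Fin L => complexGaussian (v n))
            l).comp (measurePreserving_eval (fun n => Measure.pi fun _ : Fin L =>
            complexGaussian (v n)) n)).hasLaw
      · exact fun l => (measurePreserving_eval (fun _ : Fin L => complexGaussian (v n)) l).hasLaw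
  have h2 := h1.hasLaw_pi (μ := fun p => complexGaussian (v p.1)) fun p =>
    ((measurePreserving_eval (fun _ : Fin L => complexGaussian (v p.1)) p.2).comp
      (measurePreserving_eval (fun n => Measure.pi fun _ : Fin L =>
        complexGaussian (v n)) p.1)).hasLaw
  have h3 : HasLaw (fun (f : Fin N × Fin L → ℂ) n l => f (n, l)) (columnsLaw L v)
      (Measure.pi fun p : Fin N × Fin L => complexGaussian (v p.1)) := by
    have hm : Measurable fun (f : Fin N × Fin L → ℂ) (n : Fin N) (l : Fin L) => f (n, l) :=
      measurable_pi_lambda _ fun n => measurable_pi_lambda _ fun l => measurable_pi_apply _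
    refine ⟨hm.aemeasurable, ?_⟩
    -- The flat product is the image of the nested one under uncurrying, which currying undoes.
    rw [← h2.map_eq, Measure.map_map hm (by fun_prop)]
    exact Measure.map_id
  exact h3.comp (hi.hasLaw_pi hY)

/-! ### Second-order structure of the pilot observations and the estimation errors. -/

namespace System

variable {M N K L τ : ℕ} (S : System M N K L τ)

lemma pilotVar_pos (m : Fin M) (n : Fin N) : 0 < S.pilotVar m n := by
  have h := S.pilotPower_nonneg
  have h2 : 0 ≤ ∑ i, S.β m n i := Finset.sum_nonneg fun i _ => S.β_nonneg m n i
  rw [pilotVar]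
  positivity

lemma pilotGain_nonneg : 0 ≤ τ * S.pilotPower :=
  mul_nonneg (Nat.cast_nonneg _) S.pilotPower_nonneg

lemma sqrt_pilotGain_mul_c (m : Fin M) (n : Fin N) (k : Fin K) :
    √(τ * S.pilotPower) * S.β m n k * S.c m n k = S.θ m n k := by
  have h := Real.mul_self_sqrt S.pilotGain_nonneg
  rw [c, θ]
  linear_combination (S.β m n k ^ 2 / S.pilotVar m n) * h

/-- The normal equation of linear MMSE estimation: coefficient times variance of the observation
equals the covariance of channel and observation. -/
lemma c_mul_pilotVar (m : Fin M) (n : Fin N) (k : Fin K) :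
    S.c m n k * S.pilotVar m n = √(τ * S.pilotPower) * S.β m n k := by
  rw [c, div_mul_cancel₀ _ (S.pilotVar_pos m n).ne']

lemma c_nonneg (m : Fin M) (n : Fin N) (k : Fin K) : 0 ≤ S.c m n k :=
  div_nonneg (mul_nonneg (Real.sqrt_nonneg _) (S.β_nonneg m n k)) (S.pilotVar_pos m n).le

lemma c_sq_mul_pilotVar (m : Fin M) (n : Fin N) (k : Fin K) :
    S.c m n k ^ 2 * S.pilotVar m n = S.θ m n k := by
  rw [← sqrt_pilotGain_mul_c, ← c_mul_pilotVar]
  ring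

/-- Clearing the denominator reduces this to β ≤ ∑ β. It makes the error variance β − θ admissible
as a Gaussian variance. -/
lemma θ_le_β (m : Fin M) (n : Fin N) (k : Fin K) : S.θ m n k ≤ S.β m n k := by
  have h : S.β m n k ≤ ∑ i, S.β m n i :=
    Finset.single_le_sum (fun i _ => S.β_nonneg m n i) (Finset.mem_univ k)
  rw [θ, div_le_iff₀ (S.pilotVar_pos m n), pilotVar]
  have h1 := mul_nonneg (mul_nonneg S.pilotGain_nonneg (S.β_nonneg m n k)) (sub_nonneg.mpr h)
  nlinarith [S.β_nonneg m n k]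

/-- The variances of all channel and pilot noise entries. -/
def sourceVar : (Fin M × Fin N × Fin K × Fin L) ⊕ (Fin M × Fin L × Fin τ) → ℝ :=
  Sum.elim (fun q => S.β q.1 q.2.1 q.2.2.1) fun _ => 1

/-- For the user `k` of the cluster `n`, the coefficients with which the channels and the pilot
noise of one antenna enter into its projected pilot signals (`some`) and the estimation error of
the channel of the user (`none`). -/
def antennaCoeff (n : Fin N) (k : Fin K) (m : Fin M) :
    Option (Fin N) → (Fin N × Fin K) ⊕ Fin τ → ℂ
  | some b, .inl q => if q.1 = b then (√(τ * S.pilotPower) : ℝ) else 0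
  | some b, .inr t => S.Φ t b
  | none, .inl q => (if q = (n, k) then 1 else 0) -
      S.c m n k * (if q.1 = n then (√(τ * S.pilotPower) : ℝ) else 0 : ℂ)
  | none, .inr t => -(S.c m n k * S.Φ t n)

/-- The variances of the projected pilot signals and of the estimation error. -/
def targetVar (n : Fin N) (k : Fin K) (i : (Fin M × Fin L) × Option (Fin N)) : ℝ :=
  i.2.elim (S.β i.1.1 n k - S.θ i.1.1 n k) (S.pilotVar i.1.1)

lemma targetVar_nonneg (n : Fin N) (k : Fin K) (i : (Fin M × Fin L) × Option (Fin N)) :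
    0 ≤ S.targetVar n k i := by
  rcases i with ⟨⟨m, l⟩, _ | b⟩
  · exact sub_nonneg.mpr (S.θ_le_β m n k)
  · exact (S.pilotVar_pos m b).le

lemma sourceVar_nonneg (j) : 0 ≤ S.sourceVar (L := L) j := by
  rcases j with q | q
  · exact S.β_nonneg _ _ _
  · exact zero_le_one

lemma sum_star_Φ_mul_Φ (b b' : Fin N) : ∑ t, S.Φ t b * star (S.Φ t b') = if b = b' then 1 else 0 := by
  have h := congrFun (congrFun S.Φ_orthonormal b') b
  rw [Matrix.mul_apply, Matrix.one_apply] at h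
  simp only [Matrix.conjTranspose_apply] at h
  simp_rw [mul_comm (S.Φ _ b), h, eq_comm]

/-- Orthonormal pilots keep the projected noise uncorrelated, and each cluster's channels enter only
its own projection. -/
lemma antennaCoeff_cov_some (n : Fin N) (k : Fin K) (m : Fin M) (b b' : Fin N) :
    ∑ n', ∑ k', S.antennaCoeff n k m (some b) (.inl (n', k')) * S.β m n' k' *
        star (S.antennaCoeff n k m (some b') (.inl (n', k'))) +
      ∑ t, S.antennaCoeff n k m (some b) (.inr t) * star (S.antennaCoeff n k m (some b') (.inr t)) =
    if b = b' then (S.pilotVar m b : ℂ) else 0 := by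
  have h := Real.mul_self_sqrt S.pilotGain_nonneg
  have h' : ((√(τ * S.pilotPower) : ℝ) : ℂ) * ((√(τ * S.pilotPower) : ℝ) : ℂ) =
    τ * S.pilotPower := by exact_mod_cast h
  simp only [antennaCoeff, sum_star_Φ_mul_Φ]
  by_cases hb : b = b'
  · subst hb
    simp only [if_true, pilotVar]
    rw [Finset.sum_eq_single b (fun n' _ hn' => by simp [hn']) (by simp)]
    simp only [if_true, RCLike.star_def, Complex.conj_ofReal]
    push_cast
    rw [Finset.mul_sum, add_comm]
    congr 1
    refine Finset.sum_congr rfl fun i _ => ?_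
    rw [← h']
    ring
  · simp only [hb, if_false, add_zero]
    refine Finset.sum_eq_zero fun n' _ => Finset.sum_eq_zero fun k' _ => ?_
    split_ifs with h1 h2 h2
    · exact absurd (h1.symm.trans h2) hb
    all_goals simp

lemma antennaCoeff_none_inl (n : Fin N) (k : Fin K) (m : Fin M) (q : Fin N × Fin K) :
    S.antennaCoeff n k m none (.inl q) = (if q = (n, k) then 1 else 0) -
      S.c m n k * S.antennaCoeff n k m (some n) (.inl q) := rfl

lemma antennaCoeff_none_inr (n : Fin N) (k : Fin K) (m : Fin M) (t : Fin τ) :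
    S.antennaCoeff n k m none (.inr t) =
      -(S.c m n k * S.antennaCoeff n k m (some n) (.inr t)) := rfl

lemma sum_ite_eq_pair {f : Fin N → Fin K → ℂ} (n : Fin N) (k : Fin K) :
    ∑ n', ∑ k', (if (n', k') = (n, k) then 1 else 0) * f n' k' = f n k := by
  rw [← Fintype.sum_prod_type' (f := fun n' k' => (if (n', k') = (n, k) then 1 else 0) * f n' k'),
    Finset.sum_eq_single (n, k)]
  · simp
  · intro q _ hq
    simp [hq]
  · simp

/-- The covariances of the projected pilot signals and the estimation error. -/
lemma antennaCoeff_cov (n : Fin N) (k : Fin K) (m : Fin M) (a a' : Option (Fin N)) :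
    ∑ n', ∑ k', S.antennaCoeff n k m a (.inl (n', k')) * S.β m n' k' *
        star (S.antennaCoeff n k m a' (.inl (n', k'))) +
      ∑ t, S.antennaCoeff n k m a (.inr t) * star (S.antennaCoeff n k m a' (.inr t)) =
    if a = a' then ((a.elim (S.β m n k - S.θ m n k) (S.pilotVar m) : ℝ) : ℂ) else 0 := by
  -- Orthogonality principle: the error is uncorrelated with every observation. For the user's own
  -- cluster this is the normal equation `c_mul_pilotVar`; for the others both contributions vanish.
  have hnone : ∀ b : Fin N,
      ∑ n', ∑ k', S.antennaCoeff n k m none (.inl (n', k')) * S.β m n' k' *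
        star (S.antennaCoeff n k m (some b) (.inl (n', k'))) +
      ∑ t, S.antennaCoeff n k m none (.inr t) *
        star (S.antennaCoeff n k m (some b) (.inr t)) = 0 := by
    intro b
    have h := S.antennaCoeff_cov_some n k m n b
    have h2 := sum_ite_eq_pair (f := fun n' k' => S.β m n' k' *
      star (S.antennaCoeff n k m (some b) (.inl (n', k')))) n k
    have h3 : (S.c m n k : ℂ) * S.pilotVar m n = (√(τ * S.pilotPower) : ℝ) * S.β m n k := by
      exact_mod_cast S.c_mul_pilotVar m n k
    have h4 : (S.β m n k : ℂ) * star (S.antennaCoeff n k m (some b) (.inl (n, k))) =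
        S.c m n k * if n = b then (S.pilotVar m n : ℂ) else 0 := by
      simp only [antennaCoeff]
      split_ifs
      · rw [h3, RCLike.star_def, Complex.conj_ofReal, mul_comm]
      · simp
    rw [h4, ← h, mul_add] at h2
    simp only [antennaCoeff_none_inl, antennaCoeff_none_inr]
    simp only [sub_mul, neg_mul, Finset.sum_sub_distrib, Finset.sum_neg_distrib, mul_assoc,
      h2, Finset.mul_sum]
    ring
  rcases a with _ | b <;> rcases a' with _ | b'
  · have h := hnone n
    have h2 := sum_ite_eq_pair (f := fun n' k' => S.antennaCoeff n k m none (.inl (n', k')) *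
      S.β m n' k') n k
    have h5 : (√(τ * S.pilotPower) : ℝ) * (S.β m n k : ℂ) * S.c m n k = S.θ m n k := by
      exact_mod_cast S.sqrt_pilotGain_mul_c m n k
    have h4 : S.antennaCoeff n k m none (.inl (n, k)) * S.β m n k =
        ((S.β m n k - S.θ m n k : ℝ) : ℂ) := by
      simp only [antennaCoeff, if_true]
      push_cast
      rw [← h5]
      ring
    rw [h4] at h2
    -- Only the second copy of the error is expanded, into channel minus estimate. By orthogonality
    -- the estimate contributes nothing, leaving the covariance of error and channel, β − θ.
    have h6 : ∀ n' k', S.antennaCoeff n k m none (.inl (n', k')) * S.β m n' k' *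
        star (S.antennaCoeff n k m none (.inl (n', k'))) =
        (if (n', k') = (n, k) then 1 else 0) * (S.antennaCoeff n k m none (.inl (n', k')) *
          S.β m n' k') - S.c m n k * (S.antennaCoeff n k m none (.inl (n', k')) * S.β m n' k' *
        star (S.antennaCoeff n k m (some n) (.inl (n', k')))) := by
      intro n' k'
      conv_lhs => rw [S.antennaCoeff_none_inl n k m (n', k'), star_sub, star_mul',
        ← S.antennaCoeff_none_inl n k m (n', k')]
      rw [RCLike.star_def, Complex.conj_ofReal]
      split_ifs <;> simp <;> ring
    have h7 : ∀ t, S.antennaCoeff n k m none (.inr t) *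
        star (S.antennaCoeff n k m none (.inr t)) = -(S.c m n k *
          (S.antennaCoeff n k m none (.inr t) *
            star (S.antennaCoeff n k m (some n) (.inr t)))) := by
      intro t
      conv_lhs => rw [S.antennaCoeff_none_inr n k m t, star_neg, star_mul',
        ← S.antennaCoeff_none_inr n k m t]
      rw [RCLike.star_def, Complex.conj_ofReal]
      ring
    simp only [h6, h7, Finset.sum_sub_distrib, Finset.sum_neg_distrib, h2, ← Finset.mul_sum]
    simp only [if_true, Option.elim]
    linear_combination (-(S.c m n k : ℂ)) * h
  · simpa using hnone b'
  · have h := congrArg star (hnone b)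
    simp only [star_add, star_sum, star_mul', star_star, star_zero] at h
    rw [if_neg (by simp), ← h]
    congr 1
    · refine Finset.sum_congr rfl fun n' _ => Finset.sum_congr rfl fun k' _ => ?_
      rw [RCLike.star_def, Complex.conj_ofReal]
      ring
    · refine Finset.sum_congr rfl fun t _ => ?_
      ring
  · simpa using S.antennaCoeff_cov_some n k m b b'

/-- The matrix which takes the channels and the pilot noise to the projected pilot signals and the
estimation errors of the channel of the user `k` of the cluster `n`. -/
def pilotMap (n : Fin N) (k : Fin K) : Matrix ((Fin M × Fin L) × Option (Fin N))
    ((Fin M × Fin N × Fin K × Fin L) ⊕ (Fin M × Fin L × Fin τ)) ℂ :=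
  Matrix.of fun i j => match j with
    | .inl q => if q.1 = i.1.1 ∧ q.2.2.2 = i.1.2 then
        S.antennaCoeff n k i.1.1 i.2 (.inl (q.2.1, q.2.2.1)) else 0
    | .inr q => if q.1 = i.1.1 ∧ q.2.1 = i.1.2 then S.antennaCoeff n k i.1.1 i.2 (.inr q.2.2) else 0

lemma sum_source_ite (m : Fin M) (l : Fin L)
    (f : (Fin M × Fin N × Fin K × Fin L) ⊕ (Fin M × Fin L × Fin τ) → ℂ)
    (hl : ∀ q, ¬(q.1 = m ∧ q.2.2.2 = l) → f (.inl q) = 0)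
    (hr : ∀ q, ¬(q.1 = m ∧ q.2.1 = l) → f (.inr q) = 0) :
    ∑ j, f j = ∑ n', ∑ k', f (.inl (m, n', k', l)) + ∑ t, f (.inr (m, l, t)) := by
  rw [Fintype.sum_sum_type]
  congr 1
  · rw [Fintype.sum_prod_type, Finset.sum_eq_single m
      (fun m' _ hm' => Finset.sum_eq_zero fun q _ => hl _ fun h => hm' h.1) (by simp),
      Fintype.sum_prod_type]
    refine Finset.sum_congr rfl fun n' _ => ?_
    rw [Fintype.sum_prod_type]
    refine Finset.sum_congr rfl fun k' _ => ?_
    exact Finset.sum_eq_single l (fun l' _ hl' => hl _ fun h => hl' h.2) (by simp)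
  · rw [Fintype.sum_prod_type, Finset.sum_eq_single m
      (fun m' _ hm' => Finset.sum_eq_zero fun q _ => hr _ fun h => hm' h.1) (by simp),
      Fintype.sum_prod_type]
    exact Finset.sum_eq_single l
      (fun l' _ hl' => Finset.sum_eq_zero fun q _ => hr _ fun h => hl' h.2) (by simp)

/-- Different antennas share no source, and `antennaCoeff_cov` handles a single antenna. Diagonality
relies on including the errors of one user only: errors within a cluster are in general correlated.
-/
lemma pilotMap_cov (n : Fin N) (k : Fin K) :
    S.pilotMap n k * Matrix.diagonal (fun j => (S.sourceVar j : ℂ)) * (S.pilotMap n k)ᴴ =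
      Matrix.diagonal fun i => (S.targetVar (L := L) n k i : ℂ) := by
  ext ⟨⟨m, l⟩, a⟩ ⟨⟨m', l'⟩, a'⟩
  rw [Matrix.mul_apply, sum_source_ite m l]
  rotate_left
  · intro q hq
    simp only [Matrix.mul_diagonal, pilotMap, Matrix.of_apply, hq, if_false, zero_mul]
  · intro q hq
    simp only [Matrix.mul_diagonal, pilotMap, Matrix.of_apply, hq, if_false, zero_mul]
  simp only [Matrix.mul_diagonal, Matrix.conjTranspose_apply, pilotMap, Matrix.of_apply,
    and_self, if_true, sourceVar, Sum.elim_inl, Sum.elim_inr, Complex.ofReal_one, mul_one]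
  by_cases hml : m = m' ∧ l = l'
  · obtain ⟨rfl, rfl⟩ := hml
    simp only [and_self, if_true]
    rw [antennaCoeff_cov, Matrix.diagonal_apply]
    simp [targetVar]
  · simp only [hml, if_false, star_zero, mul_zero, Finset.sum_const_zero, add_zero]
    rw [Matrix.diagonal_apply_ne]
    intro h
    simp only [Prod.mk.injEq] at h
    exact hml h.1

end System

/-! ### Second moments of products and sums of independent variables. -/

section Moments

variable {Ω : Type*} [MeasurableSpace Ω] {P : Measure Ω}

lemma memLp_of_hasLaw_complexGaussian {X : Ω → ℂ} {v : ℝ}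
    (hX : HasLaw X (complexGaussian v) P) : MemLp X 2 P := by
  have h := memLp_id_complexGaussian v
  rw [← hX.map_eq] at h
  exact h.comp_of_map hX.aemeasurable

lemma integral_of_hasLaw_complexGaussian {X : Ω → ℂ} {v : ℝ}
    (hX : HasLaw X (complexGaussian v) P) : ∫ ω, X ω ∂P = 0 := by
  rw [hX.integral_eq, integral_id_complexGaussian]

lemma integral_normSq_of_hasLaw_complexGaussian {X : Ω → ℂ} {v : ℝ} (hv : 0 ≤ v)
    (hX : HasLaw X (complexGaussian v) P) : ∫ ω, ‖X ω‖ ^ 2 ∂P = v := by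
  have h := hX.integral_comp (f := fun z : ℂ => ‖z‖ ^ 2) (by fun_prop)
  rw [integral_normSq_complexGaussian hv] at h
  exact h

lemma integral_star_mul_self {X : Ω → ℂ} :
    ∫ ω, star (X ω) * X ω ∂P = ((∫ ω, ‖X ω‖ ^ 2 ∂P : ℝ) : ℂ) := by
  rw [← integral_complex_ofReal]
  refine integral_congr_ae (.of_forall fun ω => ?_)
  simp only [RCLike.star_def, Complex.conj_mul', Complex.ofReal_pow]

/-- Independence spares the fourth moments that Cauchy–Schwarz would require. -/
lemma memLp_two_mul_of_indepFun {X Y : Ω → ℂ} (h : IndepFun X Y P) (hX : MemLp X 2 P)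
    (hY : MemLp Y 2 P) : MemLp (fun ω => X ω * Y ω) 2 P := by
  have hm : AEStronglyMeasurable (fun ω => X ω * Y ω) P :=
    hX.aestronglyMeasurable.mul hY.aestronglyMeasurable
  rw [memLp_two_iff_integrable_sq_norm hm]
  have h1 : IndepFun (fun ω => ‖X ω‖ ^ 2) (fun ω => ‖Y ω‖ ^ 2) P :=
    h.comp (φ := fun z : ℂ => ‖z‖ ^ 2) (ψ := fun z : ℂ => ‖z‖ ^ 2) (by fun_prop) (by fun_prop)
  have h2 := h1.integrable_mul ((memLp_two_iff_integrable_sq_norm hX.1).mp hX)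
    ((memLp_two_iff_integrable_sq_norm hY.1).mp hY)
  refine h2.congr (.of_forall fun ω => ?_)
  simp [mul_pow]

lemma integrable_star_mul {X Y : Ω → ℂ} (hX : MemLp X 2 P) (hY : MemLp Y 2 P) :
    Integrable (fun ω => star (X ω) * Y ω) P :=
  MemLp.integrable_mul hX.star hY

variable [IsProbabilityMeasure P] {ι : Type*} [Fintype ι] [DecidableEq ι]

/-- Mean and second moment of a random linear combination of independent complex Gaussians, the
coefficients of which are independent of the Gaussians. -/
lemma moments_sum_star_mul {ε W : ι → Ω → ℂ} {σ : ι → ℝ} (hσ : ∀ a, 0 ≤ σ a)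
    (hε : ∀ a, HasLaw (ε a) (complexGaussian (σ a)) P) (hi : iIndepFun ε P)
    (hεW : IndepFun (fun ω a => ε a ω) (fun ω a => W a ω) P) (hW : ∀ a, MemLp (W a) 2 P) :
    MemLp (fun ω => ∑ a, star (ε a ω) * W a ω) 2 P ∧
    ∫ ω, ∑ a, star (ε a ω) * W a ω ∂P = 0 ∧
    ∫ ω, ‖∑ a, star (ε a ω) * W a ω‖ ^ 2 ∂P = ∑ a, σ a * ∫ ω, ‖W a ω‖ ^ 2 ∂P := by
  have hε2 : ∀ a, MemLp (ε a) 2 P := fun a => memLp_of_hasLaw_complexGaussian (hε a)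
  have hind1 : ∀ a, IndepFun (fun ω => star (ε a ω)) (W a) P := fun a =>
    hεW.comp (φ := fun x : ι → ℂ => star (x a)) (ψ := fun x : ι → ℂ => x a) (by fun_prop)
      (by fun_prop)
  have hmem : ∀ a, MemLp (fun ω => star (ε a ω) * W a ω) 2 P := fun a =>
    memLp_two_mul_of_indepFun (hind1 a) (hε2 a).star (hW a)
  have hmean : ∀ a, ∫ ω, star (ε a ω) ∂P = 0 := by
    intro a
    have := integral_conj (μ := P) (f := ε a) (𝕜 := ℂ)
    rw [integral_of_hasLaw_complexGaussian (hε a), map_zero] at this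
    exact this
  have hcov : ∀ a b, ∫ ω, star (ε a ω) * ε b ω ∂P = if a = b then (σ a : ℂ) else 0 := by
    intro a b
    split_ifs with hab
    · subst hab
      rw [integral_star_mul_self, integral_normSq_of_hasLaw_complexGaussian (hσ a) (hε a)]
    · have h : IndepFun (fun ω => star (ε a ω)) (ε b) P :=
        (hi.indepFun hab).comp (φ := fun z : ℂ => star z) (ψ := fun z : ℂ => z) (by fun_prop)
          (by fun_prop)
      rw [h.integral_fun_mul_eq_mul_integral (hε2 a).star.1 (hε2 b).1, hmean, zero_mul]
  refine ⟨memLp_finsetSum _ fun a _ => hmem a, ?_, ?_⟩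
  · rw [integral_finsetSum _ fun a _ => (hmem a).integrable one_le_two]
    refine Finset.sum_eq_zero fun a _ => ?_
    rw [(hind1 a).integral_fun_mul_eq_mul_integral (hε2 a).star.1 (hW a).1, hmean, zero_mul]
  -- Pairing Gaussians with Gaussians and coefficients with coefficients splits each expectation.
  -- The terms with `a ≠ b` die through the Gaussian covariance, so the coefficients may depend on
  -- one another.
  · have hind2 : ∀ a b, IndepFun (fun ω => star (ε a ω) * ε b ω)
        (fun ω => star (W b ω) * W a ω) P := fun a b =>
      hεW.comp (φ := fun x : ι → ℂ => star (x a) * x b)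
        (ψ := fun x : ι → ℂ => star (x b) * x a) (by fun_prop) (by fun_prop)
    have hint : ∀ a b, Integrable
        (fun ω => (star (ε a ω) * ε b ω) * (star (W b ω) * W a ω)) P := fun a b =>
      (hind2 a b).integrable_mul (integrable_star_mul (hε2 a) (hε2 b))
        (integrable_star_mul (hW b) (hW a))
    have hexp : ∀ ω, star (∑ b, star (ε b ω) * W b ω) * ∑ a, star (ε a ω) * W a ω =
        ∑ a, ∑ b, (star (ε a ω) * ε b ω) * (star (W b ω) * W a ω) := by
      intro ω
      rw [star_sum, Finset.sum_mul_sum, Finset.sum_comm]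
      refine Finset.sum_congr rfl fun a _ => Finset.sum_congr rfl fun b _ => ?_
      rw [star_mul', star_star]
      ring
    have h := integral_star_mul_self (P := P) (X := fun ω => ∑ a, star (ε a ω) * W a ω)
    simp_rw [hexp] at h
    rw [integral_finsetSum _ fun a _ => integrable_finsetSum _ fun b _ => hint a b] at h
    have h2 : ∀ a, ∫ ω, ∑ b, (star (ε a ω) * ε b ω) * (star (W b ω) * W a ω) ∂P =
        ((σ a * ∫ ω, ‖W a ω‖ ^ 2 ∂P : ℝ) : ℂ) := by
      intro a
      rw [integral_finsetSum _ fun b _ => hint a b, Finset.sum_eq_single a]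
      · rw [(hind2 a a).integral_fun_mul_eq_mul_integral
          (integrable_star_mul (hε2 a) (hε2 a)).1 (integrable_star_mul (hW a) (hW a)).1,
          hcov, if_pos rfl, integral_star_mul_self]
        push_cast
        rfl
      · intro b _ hb
        rw [(hind2 a b).integral_fun_mul_eq_mul_integral
          (integrable_star_mul (hε2 a) (hε2 b)).1 (integrable_star_mul (hW b) (hW a)).1,
          hcov, if_neg (Ne.symm hb), zero_mul]
      · simp
    simp_rw [h2] at h
    exact_mod_cast h.symm

lemma integral_normSq_const_add {T : Ω → ℂ} (hT : MemLp T 2 P) (h0 : ∫ ω, T ω ∂P = 0) (a : ℝ) :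
    ∫ ω, ‖(a : ℂ) + T ω‖ ^ 2 ∂P = a ^ 2 + ∫ ω, ‖T ω‖ ^ 2 ∂P := by
  have hint := hT.integrable one_le_two
  have hexp : ∀ ω, ‖(a : ℂ) + T ω‖ ^ 2 = a ^ 2 + ‖T ω‖ ^ 2 + 2 * a * (T ω).re := by
    intro ω
    simp only [← Complex.normSq_eq_norm_sq, Complex.normSq_apply, Complex.add_re, Complex.add_im,
      Complex.ofReal_re, Complex.ofReal_im]
    ring
  have hsq := (memLp_two_iff_integrable_sq_norm hT.1).mp hT
  have hre : Integrable (fun ω => (T ω).re) P := hint.re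
  have hre0 : ∫ ω, (T ω).re ∂P = 0 := by
    have := integral_re (𝕜 := ℂ) hint
    rw [h0] at this
    simpa using this
  have hI : Integrable (fun ω => a ^ 2 + ‖T ω‖ ^ 2) P := (integrable_const _).add hsq
  simp_rw [hexp]
  rw [integral_add hI (hre.const_mul _),
    integral_add (integrable_const _) hsq, integral_const_mul, hre0]
  simp

/-- Residual interference after imperfect cancellation of a symbol `s` with the estimate `sh`. -/
lemma integral_normSq_mul_sub {X s sh : Ω → ℂ} (hX : MemLp X 2 P) (hs : MemLp s 2 P)
    (hsh : MemLp sh 2 P) (hind : IndepFun X (fun ω => (s ω, sh ω)) P) {a ρ : ℝ}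
    (hmean : ∫ ω, X ω ∂P = a) (hs1 : ∫ ω, ‖s ω‖ ^ 2 ∂P = 1) (hsh1 : ∫ ω, ‖sh ω‖ ^ 2 ∂P = 1)
    (hcross : ∫ ω, star (sh ω) * s ω ∂P = ρ) :
    Integrable (fun ω => ‖X ω * s ω - a * sh ω‖ ^ 2) P ∧
    ∫ ω, ‖X ω * s ω - a * sh ω‖ ^ 2 ∂P = ∫ ω, ‖X ω‖ ^ 2 ∂P + a ^ 2 - 2 * ρ * a ^ 2 := by
  have hXs : IndepFun X s P := hind.comp measurable_id measurable_fst
  have hXs2 := memLp_two_mul_of_indepFun hXs hX hs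
  have hint : Integrable (fun ω => ‖X ω * s ω - a * sh ω‖ ^ 2) P := by
    have h := hXs2.sub (hsh.const_mul (a : ℂ))
    exact (memLp_two_iff_integrable_sq_norm h.1).mp h
  refine ⟨hint, ?_⟩
  have hXss : IndepFun X (fun ω => star (sh ω) * s ω) P :=
    hind.comp (φ := fun z : ℂ => z) (ψ := fun q : ℂ × ℂ => star q.2 * q.1) measurable_id
      (by fun_prop)
  have hss := integrable_star_mul hsh hs
  have hI3 : Integrable (fun ω => X ω * (star (sh ω) * s ω)) P :=
    hXss.integrable_mul (hX.integrable one_le_two) hss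
  have hE3 : ∫ ω, X ω * (star (sh ω) * s ω) ∂P = ((a * ρ : ℝ) : ℂ) := by
    rw [hXss.integral_fun_mul_eq_mul_integral hX.1 hss.1, hmean, hcross]
    push_cast
    rfl
  have hre : ∫ ω, (X ω * (star (sh ω) * s ω)).re ∂P = a * ρ := by
    have := integral_re (𝕜 := ℂ) hI3
    rw [hE3] at this
    simpa using this
  have hN : IndepFun (fun ω => ‖X ω‖ ^ 2) (fun ω => ‖s ω‖ ^ 2) P :=
    hXs.comp (φ := fun z : ℂ => ‖z‖ ^ 2) (ψ := fun z : ℂ => ‖z‖ ^ 2) (by fun_prop) (by fun_prop)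
  have hX1 := (memLp_two_iff_integrable_sq_norm hX.1).mp hX
  have hs2 := (memLp_two_iff_integrable_sq_norm hs.1).mp hs
  have hsh2 := (memLp_two_iff_integrable_sq_norm hsh.1).mp hsh
  have hI1 : Integrable (fun ω => ‖X ω‖ ^ 2 * ‖s ω‖ ^ 2) P := hN.integrable_mul hX1 hs2
  -- The cross term carries one factor `a` from cancellation and another from the mean of `X`, hence
  -- `-2 * ρ * a ^ 2`.
  have hexp : ∀ ω, ‖X ω * s ω - a * sh ω‖ ^ 2 = ‖X ω‖ ^ 2 * ‖s ω‖ ^ 2 + a ^ 2 * ‖sh ω‖ ^ 2 -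
      2 * a * (X ω * (star (sh ω) * s ω)).re := by
    intro ω
    simp only [← Complex.normSq_eq_norm_sq, Complex.normSq_apply, Complex.sub_re, Complex.sub_im,
      Complex.mul_re, Complex.mul_im, RCLike.star_def, Complex.conj_re, Complex.conj_im,
      Complex.ofReal_re, Complex.ofReal_im]
    ring
  have hI3' : Integrable (fun ω => (X ω * (star (sh ω) * s ω)).re) P := hI3.re
  have hI2 : Integrable (fun ω => ‖X ω‖ ^ 2 * ‖s ω‖ ^ 2 + a ^ 2 * ‖sh ω‖ ^ 2) P :=
    hI1.add (hsh2.const_mul _)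
  simp_rw [hexp]
  rw [integral_sub hI2 (hI3'.const_mul _),
    integral_add hI1 (hsh2.const_mul _), integral_const_mul, integral_const_mul, hre, hsh1,
    hN.integral_fun_mul_eq_mul_integral hX1.1 hs2.1, hs1]
  ring

end Moments

/-! ### Joint law of the pilot observations and the estimation errors. -/

namespace RandomModel

variable {M N K L τ : ℕ} {S : System M N K L τ} {Ω : Type*} [MeasurableSpace Ω] {P : Measure Ω}
  (R : RandomModel S P)

/-- All channels and the pilot noise. -/
def source (ω : Ω) : (Fin M × Fin N × Fin K × Fin L) ⊕ (Fin M × Fin L × Fin τ) → ℂ :=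
  Sum.elim (fun q => R.h q.1 q.2.1 q.2.2.1 ω q.2.2.2) fun q => R.pilotNoise q.1 ω q.2.1 q.2.2

/-- The projected pilot signals and the estimation errors of the channel of the user `k` of the
cluster `n`. -/
def observed (n : Fin N) (k : Fin K) (ω : Ω) : (Fin M × Fin L) × Option (Fin N) → ℂ :=
  S.pilotMap n k *ᵥ R.source ω

lemma Hbar_apply (m : Fin M) (ω : Ω) (l : Fin L) (b : Fin N) :
    R.Hbar m ω l b = (√(τ * S.pilotPower) : ℝ) * ∑ k, R.h m b k ω l +
      ∑ t, R.pilotNoise m ω l t * S.Φ t b := by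
  have hstar : ∀ n, (star fun t => S.Φ t n) ᵥ* S.Φ = Pi.single n 1 := by
    intro n
    ext b
    have h := congrFun (congrFun S.Φ_orthonormal n) b
    rw [Matrix.mul_apply, Matrix.one_apply] at h
    rw [Pi.single_apply, Matrix.vecMul, dotProduct]
    simp_rw [eq_comm (a := b)]
    exact h
  rw [Hbar, pilotSignal, Matrix.add_mul, Matrix.smul_mul, Matrix.add_apply, Matrix.smul_apply,
    Matrix.sum_mul, Matrix.sum_apply, smul_eq_mul, Matrix.mul_apply]
  congr 2
  simp only [Matrix.sum_mul, Matrix.sum_apply, Matrix.vecMulVec_mul, hstar, Matrix.vecMulVec_apply,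
    Pi.single_apply, mul_ite, mul_one, mul_zero]
  rw [Finset.sum_eq_single b (fun n' _ hn' => by simp [Ne.symm hn']) (by simp)]
  simp

lemma observed_some (n : Fin N) (k : Fin K) (ω : Ω) (m : Fin M) (l : Fin L) (b : Fin N) :
    R.observed n k ω ((m, l), some b) = R.Hbar m ω l b := by
  rw [Hbar_apply, observed, Matrix.mulVec, dotProduct, System.sum_source_ite m l]
  rotate_left
  · intro q hq
    simp only [System.pilotMap, Matrix.of_apply, hq, if_false, zero_mul]
  · intro q hq
    simp only [System.pilotMap, Matrix.of_apply, hq, if_false, zero_mul]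
  simp only [System.pilotMap, Matrix.of_apply, and_self, if_true, System.antennaCoeff, source,
    Sum.elim_inl, Sum.elim_inr, ite_mul, zero_mul]
  congr 1
  · rw [Finset.sum_eq_single b (fun n' _ hn' => by simp [hn']) (by simp), Finset.mul_sum]
    simp
  · exact Finset.sum_congr rfl fun t _ => mul_comm _ _

lemma observed_none (n : Fin N) (k : Fin K) (ω : Ω) (m : Fin M) (l : Fin L) :
    R.observed n k ω ((m, l), none) = R.h m n k ω l - R.hHat m n k ω l := by
  rw [hHat, ← R.observed_some n k, observed, Matrix.mulVec, Matrix.mulVec, dotProduct, dotProduct,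
    System.sum_source_ite m l, System.sum_source_ite m l]
  rotate_left
  iterate 4
    · intro q hq
      simp only [System.pilotMap, Matrix.of_apply, hq, if_false, zero_mul]
  simp only [System.pilotMap, Matrix.of_apply, and_self, if_true, System.antennaCoeff_none_inl,
    System.antennaCoeff_none_inr, source, Sum.elim_inl, Sum.elim_inr, sub_mul,
    Finset.sum_sub_distrib, neg_mul, Finset.sum_neg_distrib, mul_assoc, ← Finset.mul_sum]
  rw [System.sum_ite_eq_pair (f := fun n' k' => R.h m n' k' ω l)]
  ring

lemma hasLaw_source_apply (j) :
    HasLaw (fun ω => R.source ω j) (complexGaussian (S.sourceVar j)) P := by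
  rcases j with q | q
  · exact R.h_law _ _ _ _
  · exact R.pilotNoise_law _ _ _

lemma hasLaw_source :
    HasLaw R.source (Measure.pi fun j => complexGaussian (S.sourceVar j)) P := by
  refine iIndepFun.hasLaw_pi (X := fun j ω => R.source ω j) R.hasLaw_source_apply ?_
  exact R.indep_channel_noise

/-- The covariance is diagonal by `pilotMap_cov`, and for a linear image of independent Gaussians
this forces independence. -/
lemma hasLaw_observed (n : Fin N) (k : Fin K) : HasLaw (R.observed n k)
    (Measure.pi fun i => complexGaussian (S.targetVar n k i)) P := by
  have hm : Measurable fun x => S.pilotMap (L := L) n k *ᵥ x := by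
    refine measurable_pi_lambda _ fun i => ?_
    simp only [Matrix.mulVec, dotProduct]
    fun_prop
  have h := map_mulVec_pi_complexGaussian (S.pilotMap (L := L) n k) S.sourceVar_nonneg
    (S.targetVar_nonneg n k) (S.pilotMap_cov n k)
  exact HasLaw.comp (Y := fun x => S.pilotMap n k *ᵥ x) ⟨hm.aemeasurable, h⟩ R.hasLaw_source

lemma hasLaw_observed_apply (n : Fin N) (k : Fin K) (i) :
    HasLaw (fun ω => R.observed n k ω i) (complexGaussian (S.targetVar n k i)) P :=
  (measurePreserving_eval _ i).hasLaw.comp (R.hasLaw_observed n k)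

/-- The columns of the projected pilot signal. -/
def HbarCols (m : Fin M) (ω : Ω) (b : Fin N) (l : Fin L) : ℂ := R.Hbar m ω l b

variable [IsProbabilityMeasure P]

lemma iIndepFun_observed (n : Fin N) (k : Fin K) :
    iIndepFun (fun i ω => R.observed n k ω i) P :=
  (iIndepFun_iff_hasLaw_pi_pi (R.hasLaw_observed_apply n k)).mpr (R.hasLaw_observed n k)

/-- The user only selects a vector `observed` through which the law is read; the law is the same for
all users. -/
lemma hasLaw_HbarCols (n : Fin N) (k : Fin K) (m : Fin M) :
    HasLaw (R.HbarCols m) (columnsLaw L (S.pilotVar m)) P := by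
  have h := hasLaw_columns (v := S.pilotVar m)
    (Y := fun (p : Fin N × Fin L) ω => R.observed n k ω ((m, p.2), some p.1))
    (fun p => R.hasLaw_observed_apply n k ((m, p.2), some p.1))
    ((R.iIndepFun_observed n k).precomp (g := fun p : Fin N × Fin L => ((m, p.2), some p.1))
      fun p q hpq => by simpa [Prod.ext_iff, and_comm] using hpq)
  simp only [observed_some] at h
  exact h

/-- Disjoint blocks of an independent family are independent. This decouples the precoders from the
estimation errors. -/
lemma indepFun_error_pilot (n : Fin N) (k : Fin K) :
    IndepFun (fun ω (a : Fin M × Fin L) => R.observed n k ω (a, none))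
      (fun ω (q : (Fin M × Fin L) × Fin N) => R.observed n k ω (q.1, some q.2)) P := by
  classical
  have h := (R.iIndepFun_observed n k).indepFun_finset₀
    (Finset.univ.filter fun i => i.2 = none) (Finset.univ.filter fun i => i.2 ≠ none)
    (Finset.disjoint_filter_filter_not _ _ _)
    fun i => (R.hasLaw_observed_apply n k i).aemeasurable
  exact h.comp (φ := fun x (a : Fin M × Fin L) => x ⟨(a, none), by simp⟩)
    (ψ := fun x (q : (Fin M × Fin L) × Fin N) => x ⟨(q.1, some q.2), by simp⟩)
    (measurable_pi_lambda _ fun a => measurable_pi_apply _)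
    (measurable_pi_lambda _ fun a => measurable_pi_apply _)

end RandomModel

/-! ### Precoders, effective channels and interference. -/

namespace RandomModel

variable {M N K L τ : ℕ} {S : System M N K L τ} {Ω : Type*} [MeasurableSpace Ω] {P : Measure Ω}
  (R : RandomModel S P)

lemma antennas_sub_clusters_pos (hL : N + 1 ≤ L) : (0 : ℝ) < (L : ℝ) - N := by
  have : ((N + 1 : ℕ) : ℝ) ≤ L := by exact_mod_cast hL
  push_cast at this
  linarith

lemma hasLaw_Hbar_apply (k : Fin K) (m : Fin M) (l : Fin L) (n : Fin N) :
    HasLaw (fun ω => R.Hbar m ω l n) (complexGaussian (S.pilotVar m n)) P := by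
  have h := R.hasLaw_observed_apply n k ((m, l), some n)
  simp only [observed_some] at h
  exact h

/-- The estimate is a real multiple of column `n` of `Hbar`, on which the zero-forcing direction has
product 1 or 0. This yields both the nulling and a gain free of randomness. -/
lemma star_hHat_dotProduct_w (n : Fin N) (k : Fin K) (m : Fin M) (n' : Fin N) {ω : Ω}
    (h : IsUnit ((R.Hbar m ω)ᴴ * R.Hbar m ω).det) :
    star (R.hHat m n k ω) ⬝ᵥ R.w m n' ω =
      if n = n' then ((S.c m n k / √(∫ ω', R.zfDirNormSq m n' ω' ∂P) : ℝ) : ℂ) else 0 := by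
  have h1 := congrFun (conjTranspose_mulVec_zeroForcing h n') n
  rw [Matrix.mulVec, dotProduct, Pi.single_apply] at h1
  have h2 : star (R.hHat m n k ω) ⬝ᵥ R.w m n' ω =
      ((S.c m n k / √(∫ ω', R.zfDirNormSq m n' ω' ∂P) : ℝ) : ℂ) *
        ∑ l, (R.Hbar m ω)ᴴ n l * zeroForcing (R.Hbar m ω) n' l := by
    rw [dotProduct, Finset.mul_sum]
    refine Finset.sum_congr rfl fun l _ => ?_
    simp only [Pi.star_apply, hHat, star_mul', RCLike.star_def, Complex.conj_ofReal, w,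
      Matrix.conjTranspose_apply]
    change _ * (zeroForcing (R.Hbar m ω) n' l / _) = _
    push_cast
    ring
  rw [h2, h1]
  split_ifs <;> simp

/-- The precoders as a function of the projected pilot signals. -/
def precoderOf (n' : Fin N) (z : (Fin M × Fin L) × Fin N → ℂ) (a : Fin M × Fin L) : ℂ :=
  zeroForcing (colMatrix fun b l => z ((a.1, l), b)) n' a.2 /
    ((√(∫ ω', R.zfDirNormSq a.1 n' ω' ∂P) : ℝ) : ℂ)

lemma measurable_precoderOf (n' : Fin N) : Measurable (R.precoderOf n') := by
  refine measurable_pi_lambda _ fun a => Measurable.div_const ?_ _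
  have h : Measurable fun (z : (Fin M × Fin L) × Fin N → ℂ) (b : Fin N) (l : Fin L) =>
      z ((a.1, l), b) :=
    measurable_pi_lambda _ fun b => measurable_pi_lambda _ fun l => measurable_pi_apply _
  exact (measurable_pi_apply a.2).comp ((measurable_zeroForcing n').comp h)

lemma precoderOf_observed (n : Fin N) (k : Fin K) (n' : Fin N) (ω : Ω) (a : Fin M × Fin L) :
    R.precoderOf n' (fun q => R.observed n k ω (q.1, some q.2)) a = R.w a.1 n' ω a.2 := by
  simp only [precoderOf, observed_some]
  rfl

lemma aemeasurable_w (k : Fin K) (n' : Fin N) (a : Fin M × Fin L) :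
    AEMeasurable (fun ω => R.w a.1 n' ω a.2) P := by
  have h : AEMeasurable (fun ω (q : (Fin M × Fin L) × Fin N) => R.observed n' k ω (q.1, some q.2))
      P := aemeasurable_pi_lambda _ fun q => (R.hasLaw_observed_apply n' k _).aemeasurable
  have h2 := ((measurable_pi_apply a).comp (R.measurable_precoderOf n')).comp_aemeasurable h
  refine h2.congr (.of_forall fun ω => ?_)
  exact R.precoderOf_observed n' k n' ω a

lemma sum_normSq_w (m : Fin M) (n' : Fin N) (ω : Ω) :
    ∑ l, ‖R.w m n' ω l‖ ^ 2 =
      R.zfDirNormSq m n' ω / √(∫ ω', R.zfDirNormSq m n' ω' ∂P) ^ 2 := by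
  simp only [w, norm_div, div_pow, zfDirNormSq, Finset.sum_div, Complex.norm_real,
    Real.norm_eq_abs, sq_abs]

/-- The part of the effective channel which is due to the channel estimation errors. -/
def errorChannel (n : Fin N) (k : Fin K) (n' : Fin N) (ω : Ω) : ℂ :=
  ∑ a : Fin M × Fin L, star (R.observed n k ω (a, none)) * R.w a.1 n' ω a.2

/-- The effective channel as a function of the channels and the pilot noise. -/
def effectiveChannelOf (n : Fin N) (k : Fin K) (n' : Fin N)
    (q : (Fin M × Fin N × Fin K × Fin L → ℂ) × (Fin M × Fin L × Fin τ → ℂ)) : ℂ :=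
  ∑ m, ∑ l, star (q.1 (m, n, k, l)) *
    R.precoderOf n' (fun a => (S.pilotMap n k *ᵥ Sum.elim q.1 q.2) (a.1, some a.2)) (m, l)

lemma measurable_effectiveChannelOf (n : Fin N) (k : Fin K) (n' : Fin N) :
    Measurable (R.effectiveChannelOf n k n') := by
  have h : Measurable fun (q : (Fin M × Fin N × Fin K × Fin L → ℂ) × (Fin M × Fin L × Fin τ → ℂ))
      (a : (Fin M × Fin L) × Fin N) => (S.pilotMap n k *ᵥ Sum.elim q.1 q.2) (a.1, some a.2) := by
    refine measurable_pi_lambda _ fun a => ?_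
    simp only [Matrix.mulVec, dotProduct, Fintype.sum_sum_type, Sum.elim_inl, Sum.elim_inr]
    fun_prop
  have h2 := (R.measurable_precoderOf n').comp h
  refine Finset.measurable_sum _ fun m _ => Finset.measurable_sum _ fun l _ => Measurable.mul ?_ ?_
  · fun_prop
  · exact (measurable_pi_apply (m, l)).comp h2

lemma memLp_sHat (n : Fin N) (i : Fin K) : MemLp (R.sHat n i) 2 P :=
  memLp_of_hasLaw_complexGaussian (R.sHat_law n i)

lemma memLp_s (n : Fin N) (i : Fin K) : MemLp (R.s n i) 2 P :=
  ((R.memLp_sHat n i).const_mul _).add (memLp_of_hasLaw_complexGaussian (R.e_law n i))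

lemma integral_normSq_sHat (n : Fin N) (i : Fin K) : ∫ ω, ‖R.sHat n i ω‖ ^ 2 ∂P = 1 :=
  integral_normSq_of_hasLaw_complexGaussian zero_le_one (R.sHat_law n i)

lemma integrable_normSq_hHat (n : Fin N) (k : Fin K) (m : Fin M) (l : Fin L) :
    Integrable (fun ω => ‖R.hHat m n k ω l‖ ^ 2) P := by
  have h := (memLp_of_hasLaw_complexGaussian (R.hasLaw_Hbar_apply k m l n)).const_mul
    (S.c m n k : ℂ)
  exact (memLp_two_iff_integrable_sq_norm h.1).mp h

lemma integral_normSq_hHat (n : Fin N) (k : Fin K) (m : Fin M) (l : Fin L) :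
    ∫ ω, ‖R.hHat m n k ω l‖ ^ 2 ∂P = S.θ m n k := by
  have h := integral_normSq_of_hasLaw_complexGaussian (S.pilotVar_pos m n).le
    (R.hasLaw_Hbar_apply k m l n)
  simp only [hHat, norm_mul, mul_pow, Complex.norm_real, Real.norm_eq_abs, sq_abs]
  rw [integral_const_mul, h, S.c_sq_mul_pilotVar]

lemma integral_star_sHat_mul_e (n : Fin N) (i : Fin K) :
    ∫ ω, star (R.sHat n i ω) * R.e n i ω ∂P = 0 := by
  have h : IndepFun (fun ω => star (R.sHat n i ω)) (R.e n i) P :=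
    (R.indep_sHat_e n i).comp (φ := fun z : ℂ => star z) (ψ := fun z : ℂ => z) (by fun_prop)
      (by fun_prop)
  rw [h.integral_fun_mul_eq_mul_integral (R.memLp_sHat n i).star.1
    (memLp_of_hasLaw_complexGaussian (R.e_law n i)).1,
    integral_of_hasLaw_complexGaussian (R.e_law n i), mul_zero]

/-- The effective channel is a measurable function of channels and pilot noise alone, which the data
are independent of. -/
lemma indepFun_η_data (n : Fin N) (k : Fin K) (n' : Fin N) (i : Fin K) :
    IndepFun (R.η n k n') (fun ω => (R.s n i ω, R.sHat n i ω)) P := by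
  have h := R.indep_data_channel.symm.comp (R.measurable_effectiveChannelOf n k n')
    (ψ := fun d : Fin N × Fin K → ℂ × ℂ =>
      ((S.ρ n i : ℂ) * (d (n, i)).1 + (d (n, i)).2, (d (n, i)).1)) (by fun_prop)
  obtain h1 : R.η n k n' = R.effectiveChannelOf n k n' ∘ fun ω =>
      ((fun q : Fin M × Fin N × Fin K × Fin L => R.h q.1 q.2.1 q.2.2.1 ω q.2.2.2),
        fun q : Fin M × Fin L × Fin τ => R.pilotNoise q.1 ω q.2.1 q.2.2) := by
    funext ω
    rw [η]
    refine Finset.sum_congr rfl fun m _ => ?_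
    rw [dotProduct]
    refine Finset.sum_congr rfl fun l _ => ?_
    rw [← R.precoderOf_observed n k n' ω (m, l)]
    rfl
  rw [h1]
  exact h

lemma integral_star_sHat_mul_s (n : Fin N) (i : Fin K) :
    ∫ ω, star (R.sHat n i ω) * R.s n i ω ∂P = S.ρ n i := by
  have h1 := integrable_star_mul (R.memLp_sHat n i) (R.memLp_sHat n i)
  have h2 := integrable_star_mul (R.memLp_sHat n i)
    (memLp_of_hasLaw_complexGaussian (R.e_law n i))
  have hexp : ∀ ω, star (R.sHat n i ω) * R.s n i ω =
      S.ρ n i * (star (R.sHat n i ω) * R.sHat n i ω) + star (R.sHat n i ω) * R.e n i ω := by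
    intro ω
    rw [s]
    ring
  simp_rw [hexp]
  rw [integral_add (h1.const_mul _) h2, integral_const_mul, integral_star_mul_self,
    R.integral_normSq_sHat, R.integral_star_sHat_mul_e]
  simp

lemma integral_normSq_s (n : Fin N) (i : Fin K) : ∫ ω, ‖R.s n i ω‖ ^ 2 ∂P = 1 := by
  have hρ : 0 ≤ 1 - S.ρ n i ^ 2 := by nlinarith [S.ρ_nonneg n i, S.ρ_le_one n i]
  have he := memLp_of_hasLaw_complexGaussian (R.e_law n i)
  have hI1 := (memLp_two_iff_integrable_sq_norm (R.memLp_sHat n i).1).mp (R.memLp_sHat n i)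
  have hI2 := (memLp_two_iff_integrable_sq_norm he.1).mp he
  have hI3 := integrable_star_mul (R.memLp_sHat n i) he
  have hI3' : Integrable (fun ω => (star (R.sHat n i ω) * R.e n i ω).re) P := hI3.re
  have hre : ∫ ω, (star (R.sHat n i ω) * R.e n i ω).re ∂P = 0 := by
    have := integral_re (𝕜 := ℂ) hI3
    rw [R.integral_star_sHat_mul_e] at this
    simpa using this
  have hexp : ∀ ω, ‖R.s n i ω‖ ^ 2 = S.ρ n i ^ 2 * ‖R.sHat n i ω‖ ^ 2 + ‖R.e n i ω‖ ^ 2 +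
      2 * S.ρ n i * (star (R.sHat n i ω) * R.e n i ω).re := by
    intro ω
    simp only [s, ← Complex.normSq_eq_norm_sq, Complex.normSq_apply, Complex.add_re, Complex.add_im,
      Complex.mul_re, Complex.mul_im, RCLike.star_def, Complex.conj_re, Complex.conj_im,
      Complex.ofReal_re, Complex.ofReal_im]
    ring
  have hI12 : Integrable (fun ω => S.ρ n i ^ 2 * ‖R.sHat n i ω‖ ^ 2 + ‖R.e n i ω‖ ^ 2) P :=
    (hI1.const_mul _).add hI2
  simp_rw [hexp]
  rw [integral_add hI12 (hI3'.const_mul _), integral_add (hI1.const_mul _) hI2,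
    integral_const_mul, integral_const_mul, hre, R.integral_normSq_sHat,
    integral_normSq_of_hasLaw_complexGaussian hρ (R.e_law n i)]
  ring

variable [IsProbabilityMeasure P]

lemma ae_isUnit_det_gram_Hbar (hL : N + 1 ≤ L) (n : Fin N) (k : Fin K) (m : Fin M) :
    ∀ᵐ ω ∂P, IsUnit ((R.Hbar m ω)ᴴ * R.Hbar m ω).det := by
  have h := ae_isUnit_det_gram hL (S.pilotVar_pos m)
  rw [← (R.hasLaw_HbarCols n k m).map_eq] at h
  exact ae_of_ae_map (R.hasLaw_HbarCols n k m).aemeasurable h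

lemma integrable_zfDirNormSq (hL : N + 1 ≤ L) (k : Fin K) (m : Fin M) (n' : Fin N) :
    Integrable (R.zfDirNormSq m n') P := by
  have h := integrable_sum_normSq_zeroForcing hL (S.pilotVar_pos m) n'
  rw [← (R.hasLaw_HbarCols n' k m).map_eq] at h
  exact h.comp_aemeasurable (R.hasLaw_HbarCols n' k m).aemeasurable

lemma integral_zfDirNormSq (hL : N + 1 ≤ L) (k : Fin K) (m : Fin M) (n' : Fin N) :
    ∫ ω, R.zfDirNormSq m n' ω ∂P = 1 / (S.pilotVar m n' * ((L : ℝ) - N)) := by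
  have h := integrable_sum_normSq_zeroForcing hL (S.pilotVar_pos m) n'
  rw [← integral_sum_normSq_zeroForcing hL (S.pilotVar_pos m) n']
  exact (R.hasLaw_HbarCols n' k m).integral_comp h.aestronglyMeasurable

lemma integral_zfDirNormSq_pos (hL : N + 1 ≤ L) (k : Fin K) (m : Fin M) (n' : Fin N) :
    0 < ∫ ω, R.zfDirNormSq m n' ω ∂P := by
  rw [R.integral_zfDirNormSq hL k]
  exact one_div_pos.mpr (mul_pos (S.pilotVar_pos m n') (antennas_sub_clusters_pos hL))

/-- The normalization turns `c` into c·√(pilotVar·(L − N)), and c²·pilotVar = θ. -/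
lemma c_div_sqrt_integral_zfDirNormSq (hL : N + 1 ≤ L) (n : Fin N) (k : Fin K) (m : Fin M) :
    S.c m n k / √(∫ ω, R.zfDirNormSq m n ω ∂P) = √((L : ℝ) - N) * √(S.θ m n k) := by
  have hp := S.pilotVar_pos m n
  have hl := antennas_sub_clusters_pos hL
  rw [R.integral_zfDirNormSq hL k, one_div, Real.sqrt_inv, div_inv_eq_mul,
    ← S.c_sq_mul_pilotVar m n k, Real.sqrt_mul hp.le, Real.sqrt_mul (sq_nonneg _),
    Real.sqrt_sq (S.c_nonneg m n k)]
  ring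

lemma memLp_w (hL : N + 1 ≤ L) (k : Fin K) (n' : Fin N) (a : Fin M × Fin L) :
    MemLp (fun ω => R.w a.1 n' ω a.2) 2 P := by
  have hm := (R.aemeasurable_w k n' a).aestronglyMeasurable
  rw [memLp_two_iff_integrable_sq_norm hm]
  have h := (R.integrable_zfDirNormSq hL k a.1 n').div_const
    (√(∫ ω', R.zfDirNormSq a.1 n' ω' ∂P) ^ 2)
  refine h.mono (hm.norm.pow 2) (.of_forall fun ω => ?_)
  rw [← sum_normSq_w, Real.norm_of_nonneg (by positivity), Real.norm_of_nonneg (by positivity)]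
  exact Finset.single_le_sum (f := fun l => ‖R.w a.1 n' ω l‖ ^ 2) (fun _ _ => by positivity)
    (Finset.mem_univ a.2)

lemma sum_integral_normSq_w (hL : N + 1 ≤ L) (k : Fin K) (m : Fin M) (n' : Fin N) :
    ∑ l, ∫ ω, ‖R.w m n' ω l‖ ^ 2 ∂P = 1 := by
  have hw : ∀ l, Integrable (fun ω => ‖R.w m n' ω l‖ ^ 2) P := fun l =>
    (memLp_two_iff_integrable_sq_norm (R.memLp_w hL k n' (m, l)).1).mp (R.memLp_w hL k n' (m, l))
  rw [← integral_finsetSum _ fun l _ => hw l]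
  simp_rw [sum_normSq_w]
  have h := R.integral_zfDirNormSq_pos hL k m n'
  rw [integral_div, Real.sq_sqrt h.le, div_self h.ne']

/-- Writing the channel as estimate plus error, the estimate contributes a constant wherever all
Gram matrices are invertible. -/
lemma η_ae_eq (hL : N + 1 ≤ L) (n : Fin N) (k : Fin K) (n' : Fin N) :
    ∀ᵐ ω ∂P, R.η n k n' ω = ((if n = n' then √((L : ℝ) - N) * ∑ m, √(S.θ m n k) else 0 : ℝ) : ℂ) +
      R.errorChannel n k n' ω := by
  filter_upwards [ae_all_iff.mpr fun m => R.ae_isUnit_det_gram_Hbar hL n k m] with ω hω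
  have h1 : ∀ m, star (R.h m n k ω) ⬝ᵥ R.w m n' ω = star (R.hHat m n k ω) ⬝ᵥ R.w m n' ω +
      ∑ l, star (R.observed n k ω ((m, l), none)) * R.w m n' ω l := by
    intro m
    rw [dotProduct, dotProduct, ← Finset.sum_add_distrib]
    refine Finset.sum_congr rfl fun l _ => ?_
    rw [observed_none, star_sub, Pi.star_apply, Pi.star_apply]
    ring
  rw [η, errorChannel, Fintype.sum_prod_type]
  simp_rw [h1]
  rw [Finset.sum_add_distrib]
  congr 1
  simp_rw [R.star_hHat_dotProduct_w n k _ n' (hω _)]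
  by_cases hn : n = n'
  · subst hn
    simp only [if_true, R.c_div_sqrt_integral_zfDirNormSq hL n k]
    push_cast
    rw [Finset.mul_sum]
  · simp [hn]

/-- Each access point contributes its error variance times the mean squared norm 1 of its precoder,
whatever the beam. -/
lemma moments_errorChannel (hL : N + 1 ≤ L) (n : Fin N) (k : Fin K) (n' : Fin N) :
    MemLp (R.errorChannel n k n') 2 P ∧ ∫ ω, R.errorChannel n k n' ω ∂P = 0 ∧
      ∫ ω, ‖R.errorChannel n k n' ω‖ ^ 2 ∂P = ∑ m, (S.β m n k - S.θ m n k) := by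
  have hind : IndepFun (fun ω (a : Fin M × Fin L) => R.observed n k ω (a, none))
      (fun ω (a : Fin M × Fin L) => R.w a.1 n' ω a.2) P := by
    have h := (R.indepFun_error_pilot n k).comp measurable_id (R.measurable_precoderOf n')
    have hw : (fun ω (a : Fin M × Fin L) => R.w a.1 n' ω a.2) = R.precoderOf n' ∘
        fun ω (q : (Fin M × Fin L) × Fin N) => R.observed n k ω (q.1, some q.2) := by
      funext ω a
      exact (R.precoderOf_observed n k n' ω a).symm
    rw [hw]
    exact h
  have h := moments_sum_star_mul (fun a => S.targetVar_nonneg n k (a, none))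
    (fun a => R.hasLaw_observed_apply n k (a, none))
    ((R.iIndepFun_observed n k).precomp (g := fun a : Fin M × Fin L => (a, none))
      fun a b hab => by simpa using hab) hind (R.memLp_w hL k n')
  refine ⟨h.1, h.2.1, h.2.2.trans ?_⟩
  rw [Fintype.sum_prod_type]
  refine Finset.sum_congr rfl fun m _ => ?_
  simp only [System.targetVar, Option.elim]
  rw [← Finset.mul_sum, R.sum_integral_normSq_w hL k, mul_one]

lemma memLp_η (hL : N + 1 ≤ L) (n : Fin N) (k : Fin K) (n' : Fin N) :
    MemLp (R.η n k n') 2 P := by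
  have h : MemLp (fun ω => ((if n = n' then √((L : ℝ) - N) * ∑ m, √(S.θ m n k) else 0 : ℝ) : ℂ) +
      R.errorChannel n k n' ω) 2 P :=
    MemLp.add (memLp_const _) (R.moments_errorChannel hL n k n').1
  have hae : (fun ω => ((if n = n' then √((L : ℝ) - N) * ∑ m, √(S.θ m n k) else 0 : ℝ) : ℂ) +
      R.errorChannel n k n' ω) =ᵐ[P] R.η n k n' := by
    filter_upwards [R.η_ae_eq hL n k n'] with ω hω
    exact hω.symm
  exact h.ae_eq hae

lemma integral_η (hL : N + 1 ≤ L) (n : Fin N) (k : Fin K) :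
    ∫ ω, R.η n k n ω ∂P = ((√((L : ℝ) - N) * ∑ m, √(S.θ m n k) : ℝ) : ℂ) := by
  have h := R.moments_errorChannel hL n k n
  rw [integral_congr_ae (R.η_ae_eq hL n k n),
    integral_add (integrable_const _) (h.1.integrable one_le_two), h.2.1]
  simp

lemma integral_normSq_η (hL : N + 1 ≤ L) (n : Fin N) (k : Fin K) (n' : Fin N) :
    ∫ ω, ‖R.η n k n' ω‖ ^ 2 ∂P =
      (if n = n' then √((L : ℝ) - N) * ∑ m, √(S.θ m n k) else 0) ^ 2 +
        ∑ m, (S.β m n k - S.θ m n k) := by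
  have h := R.moments_errorChannel hL n k n'
  rw [← h.2.2, ← integral_normSq_const_add h.1 h.2.1]
  refine integral_congr_ae ?_
  filter_upwards [R.η_ae_eq hL n k n'] with ω hω
  rw [hω]

lemma integral_normSq_η_sub_mean (hL : N + 1 ≤ L) (n : Fin N) (k : Fin K) :
    ∫ ω, ‖R.η n k n ω - ∫ ω', R.η n k n ω' ∂P‖ ^ 2 ∂P = ∑ m, (S.β m n k - S.θ m n k) := by
  rw [← (R.moments_errorChannel hL n k n).2.2]
  refine integral_congr_ae ?_
  filter_upwards [R.η_ae_eq hL n k n] with ω hω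
  rw [hω, R.integral_η hL, if_pos rfl, add_sub_cancel_left]

lemma residual_interference (hL : N + 1 ≤ L) (n : Fin N) (k i : Fin K) :
    Integrable (fun ω =>
      ‖R.η n k n ω * R.s n i ω - (∫ ω', R.η n k n ω' ∂P) * R.sHat n i ω‖ ^ 2) P ∧
    ∫ ω, ‖R.η n k n ω * R.s n i ω - (∫ ω', R.η n k n ω' ∂P) * R.sHat n i ω‖ ^ 2 ∂P =
      ∑ m, (S.β m n k - S.θ m n k) +
        (2 - 2 * S.ρ n i) * (√((L : ℝ) - N) * ∑ m, √(S.θ m n k)) ^ 2 := by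
  have h := integral_normSq_mul_sub (R.memLp_η hL n k n) (R.memLp_s n i) (R.memLp_sHat n i)
    (R.indepFun_η_data n k n i) (R.integral_η hL n k) (R.integral_normSq_s n i)
    (R.integral_normSq_sHat n i) (R.integral_star_sHat_mul_s n i)
  rw [R.integral_η hL]
  refine ⟨h.1, h.2.trans ?_⟩
  rw [R.integral_normSq_η hL, if_pos rfl]
  ring

/-- Every power meets the error variance ∑ₘ(β − θ) exactly once, which produces the total power. The
squared mean of the effective channel is met only by the users before `k`, and with weight 2 − 2ρ by
those after `k`. -/
lemma interference_eq (hL : N + 1 ≤ L) (n : Fin N) (k : Fin K) :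
    R.interference n k = ((L : ℝ) - N) * (∑ m, √(S.θ m n k)) ^ 2 *
        (∑ i ∈ Finset.Iio k, S.p n i + ∑ i ∈ Finset.Ioi k, S.p n i * (2 - 2 * S.ρ n i))
      + (∑ n', S.clusterPower n') * (∑ m, (S.β m n k - S.θ m n k)) + 1 := by
  have hsum : S.clusterPower n =
      ∑ i ∈ Finset.Iio k, S.p n i + S.p n k + ∑ i ∈ Finset.Ioi k, S.p n i := by
    have h : (Finset.univ : Finset (Fin K)) = (Finset.Iio k).disjUnion
        (Finset.cons k (Finset.Ioi k) (by simp)) (by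
          rw [Finset.disjoint_left]
          intro i hi
          simp only [Finset.mem_Iio, Finset.mem_cons, Finset.mem_Ioi] at hi ⊢
          omega) := by
      ext i
      simp only [Finset.mem_univ, Finset.mem_disjUnion, Finset.mem_Iio, Finset.mem_cons,
        Finset.mem_Ioi, true_iff]
      omega
    rw [System.clusterPower, h, Finset.sum_disjUnion, Finset.sum_cons, add_assoc]
  have hpow : ∑ n', S.clusterPower n' =
      S.clusterPower n + ∑ n' ∈ Finset.univ.erase n, S.clusterPower n' :=
    (Finset.add_sum_erase _ _ (Finset.mem_univ n)).symm
  have hinter : ∑ n' ∈ Finset.univ.erase n, S.clusterPower n' * (∫ ω, ‖R.η n k n' ω‖ ^ 2 ∂P) =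
      (∑ n' ∈ Finset.univ.erase n, S.clusterPower n') * ∑ m, (S.β m n k - S.θ m n k) := by
    rw [Finset.sum_mul]
    refine Finset.sum_congr rfl fun n' hn' => ?_
    rw [R.integral_normSq_η hL, if_neg (Finset.ne_of_mem_erase hn').symm]
    ring
  have hsq := Real.sq_sqrt (antennas_sub_clusters_pos hL).le
  simp only [interference, hinter, R.integral_normSq_η_sub_mean hL,
    (R.residual_interference hL n k _).2, R.integral_normSq_η hL n k n, if_true, hpow, hsum,
    ← Finset.sum_mul, mul_pow, hsq, mul_add, Finset.sum_add_distrib]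
  simp only [← mul_assoc, ← Finset.sum_mul]
  ring

lemma interference_pos (hL : N + 1 ≤ L) (n : Fin N) (k : Fin K) : 0 < R.interference n k := by
  rw [R.interference_eq hL]
  have h1 := (antennas_sub_clusters_pos hL).le
  have h2 : 0 ≤ ∑ m, (S.β m n k - S.θ m n k) :=
    Finset.sum_nonneg fun m _ => sub_nonneg.mpr (S.θ_le_β m n k)
  have h3 : 0 ≤ ∑ n', S.clusterPower n' :=
    Finset.sum_nonneg fun n' _ => Finset.sum_nonneg fun i _ => S.p_nonneg n' i
  have h4 : 0 ≤ ∑ i ∈ Finset.Iio k, S.p n i := Finset.sum_nonneg fun i _ => S.p_nonneg n i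
  have h5 : 0 ≤ ∑ i ∈ Finset.Ioi k, S.p n i * (2 - 2 * S.ρ n i) :=
    Finset.sum_nonneg fun i _ => mul_nonneg (S.p_nonneg n i) (by linarith [S.ρ_le_one n i])
  positivity

end RandomModel

end CellFree

end

theorem theorem2 {M N K L τ : ℕ} (hL : N + 1 ≤ L)
    (S : CellFree.System M N K L τ)
    {Ω : Type*} [MeasurableSpace Ω] (P : Measure Ω) [IsProbabilityMeasure P]
    (R : CellFree.RandomModel S P) (n : Fin N) (k : Fin K) :
    -- the precoder is well defined: the Gram matrices are almost surely invertible and the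
    -- normalization constants are finite and positive
    (∀ m, ∀ᵐ ω ∂P, IsUnit ((R.Hbar m ω)ᴴ * R.Hbar m ω).det) ∧
    (∀ m n', Integrable (R.zfDirNormSq m n') P ∧ 0 < ∫ ω, R.zfDirNormSq m n' ω ∂P) ∧
    -- `θ m n k` is the mean power per antenna of the channel estimate
    (∀ m, Integrable (fun ω => ∑ l, ‖R.hHat m n k ω l‖ ^ 2) P ∧
      S.θ m n k = 1 / (L : ℝ) * ∫ ω, ∑ l, ‖R.hHat m n k ω l‖ ^ 2 ∂P) ∧
    -- inter-cluster interference through the estimated channel is nulled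
    (∀ m n', n' ≠ n → ∀ᵐ ω ∂P, star (R.hHat m n k ω) ⬝ᵥ R.w m n' ω = 0) ∧
    -- the expectations in the effective SINR exist and its denominator is positive
    (∀ n', MemLp (R.η n k n') 2 P) ∧
    (∀ i, Integrable (fun ω =>
      ‖R.η n k n ω * R.s n i ω - (∫ ω', R.η n k n ω' ∂P) * R.sHat n i ω‖ ^ 2) P) ∧
    0 < R.interference n k ∧
    -- the closed form
    R.sinr n k =
      ((L : ℝ) - N) * S.p n k * (∑ m, √(S.θ m n k)) ^ 2 /
        (((L : ℝ) - N) * (∑ m, √(S.θ m n k)) ^ 2 *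
            (∑ i ∈ Finset.Iio k, S.p n i + ∑ i ∈ Finset.Ioi k, S.p n i * (2 - 2 * S.ρ n i))
          + (∑ n', S.clusterPower n') * (∑ m, (S.β m n k - S.θ m n k)) + 1) := by
  have hL0 : (L : ℝ) ≠ 0 := Nat.cast_ne_zero.mpr (by omega)
  refine ⟨fun m => R.ae_isUnit_det_gram_Hbar hL n k m,
    fun m n' => ⟨R.integrable_zfDirNormSq hL k m n', R.integral_zfDirNormSq_pos hL k m n'⟩,
    fun m => ⟨integrable_finsetSum _ fun l _ => R.integrable_normSq_hHat n k m l, ?_⟩,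
    fun m n' hn' => ?_, R.memLp_η hL n k, fun i => (R.residual_interference hL n k i).1,
    R.interference_pos hL n k, ?_⟩
  · rw [integral_finsetSum _ fun l _ => R.integrable_normSq_hHat n k m l]
    simp only [R.integral_normSq_hHat, Finset.sum_const, Finset.card_univ, Fintype.card_fin,
      nsmul_eq_mul]
    field_simp
  · filter_upwards [R.ae_isUnit_det_gram_Hbar hL n k m] with ω hω
    rw [R.star_hHat_dotProduct_w n k m n' hω, if_neg hn'.symm]
  · rw [CellFree.RandomModel.sinr, R.interference_eq hL, R.integral_η hL, Complex.norm_real,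
      Real.norm_eq_abs, sq_abs, mul_pow,
      Real.sq_sqrt (CellFree.RandomModel.antennas_sub_clusters_pos hL).le]
    ring_nf
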